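/- For every integer $d \ge 2$ there is a constant $c_1 > 0$, depending only on $d$, such that the following holds. Let $n \ge d$ and $k$ be integers, let $0 \le q_n < p_n \le 1$, and let $\Phi^* : [n] \to [k]$ be an assignment of the nodes to communities, with community sizes $s_a = |(\Phi^*)^{-1}(a)|$ and $s_{\min} = \min_a s_a$. Let $\mathcal E$ be the set of $d$-element subsets of $[n]$, and let $\mathcal H = ([n], (W_e)_{e \in \mathcal E})$ be sampled from the weighted $d$-uniform hypergraph stochastic block model: the $W_e$ are independent random variables with values in $[0,1]$ and arbitrary distributions such that $\mathbb E[W_e] = p_n$ if all nodes of $e$ lie in the same community, and $\mathbb E[W_e] = q_n$ otherwise. Let $\mathbf A \in \mathbb R^{n \times n}$ be the similarity matrix, $\mathbf A_{ij} = \sum_{e \in \mathcal E :\, \{i,j\} \subseteq e} W_e$ for $i \ne j$ and $\mathbf A_{ii} = 0$, and let $\mathbf X^*$ be the ground-truth cluster matrix, $\mathbf X^*_{ij} = 1$ if $\Phi^*(i) = \Phi^*(j)$ and $\mathbf X^*_{ij} = 0$ otherwise. Put $$p_n^- = \min_{1 \le a \le k} \left[ \binom{s_a-2}{d-2}(p_n-q_n)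 + \binom{n-2}{d-2} q_n \right], \qquad q_n^+ = \binom{n-2}{d-2} q_n$$ (the minimum expected similarity of two nodes in the same community, and the expected similarity of two nodes in different communities). If $$\tfrac14 p_n^- + \tfrac34 q_n^+ \le \lambda \le \tfrac34 p_n^- + \tfrac14 q_n^+$$ and $$s_{\min}^2 \binom{s_{\min}-2}{d-2}^2 (p_n-q_n)^2 \ \ge\ c_1 \binom{n-2}{d-2}\, p_n \left( s_{\min} \log n + n \right),$$ then with probability greater than $1 - 6 n^{-11}$ the matrix $\mathbf X^*$ is the unique optimal solution of the semidefinite program $$\max_{\mathbf X \in \mathbb R^{n \times n}} \ \langle \mathbf A - \lambda \mathbf 1_{n \times n}, \mathbf X \rangle \quad \text{subject to} \quad \mathbf X \succeq \mathbf O, \quad \langle \mathbf I_n, \mathbf X \rangle = n, \quad 0 \le \mathbf X_{ij} \le 1 \ \text{ for all } i, j \in [n].$$ Here $\mathbf 1_{n \times n}$ is the all-one matrix, $\langle \cdot, \cdot \rangle$ is the entrywise inner product, and $\mathbf X \succeq \mathbf O$ means that $\mathbf X$ is symmetric and positive semidefinite. In the binomial coefficients a negative $s-2$ is read as $0$. 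-/

import Mathlib

open MeasureTheory ProbabilityTheory

namespace HypergraphSBM

/-- The set of all `d`-element subsets (edges) of the vertex set `[n]`. -/
abbrev Edge (n d : ℕ) : Type := {e : Finset (Fin n) // e.card = d}

/-- An edge is homogeneous for the community assignment `Φ` if all of its nodes lie in one
community. -/
def IsHomogeneous {n k d : ℕ} (Φ : Fin n → Fin k) (e : Edge n d) : Prop :=
  ∀ i ∈ e.1, ∀ j ∈ e.1, Φ i = Φ j

/-- The random weights `W` on a probability space `(Ω, μ)` form a sample of the weighted
`d`-uniform hypergraph stochastic block model with parameters `n, k, p, q, Φ`. Only the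
expectations of the weights are prescribed, not their distributions. -/
structure IsWHSBM {Ω : Type*} [MeasurableSpace Ω] (μ : Measure Ω) {n k d : ℕ} (p q : ℝ)
    (Φ : Fin n → Fin k) (W : Edge n d → Ω → ℝ) : Prop where
  p_mem : p ∈ Set.Icc (0 : ℝ) 1
  q_mem : q ∈ Set.Icc (0 : ℝ) 1
  measurable : ∀ e, Measurable (W e)
  weight_mem : ∀ e, ∀ᵐ ω ∂μ, W e ω ∈ Set.Icc (0 : ℝ) 1
  indep : iIndepFun W μ
  mean_homogeneous : ∀ e, IsHomogeneous Φ e → ∫ ω, W e ω ∂μ = p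
  mean_heterogeneous : ∀ e, ¬ IsHomogeneous Φ e → ∫ ω, W e ω ∂μ = q

/-- The similarity matrix of a weighted `d`-uniform hypergraph: off the diagonal, the total weight
of the edges containing both nodes; zero on the diagonal. -/
def similarityMatrix {n d : ℕ} (w : Edge n d → ℝ) : Matrix (Fin n) (Fin n) ℝ :=
  Matrix.of fun i j => if i = j then 0 else ∑ e : Edge n d with i ∈ e.1 ∧ j ∈ e.1, w e

/-- The membership matrix of a community assignment. -/
def membershipMatrix {n k : ℕ} (Φ : Fin n → Fin k) : Matrix (Fin n) (Fin k) ℝ :=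
  Matrix.of fun i a => if a = Φ i then 1 else 0

/-- The cluster matrix `Z Zᵀ` of a community assignment. -/
def clusterMatrix {n k : ℕ} (Φ : Fin n → Fin k) : Matrix (Fin n) (Fin n) ℝ :=
  membershipMatrix Φ * (membershipMatrix Φ).transpose

/-- The size of community `a`. -/
def communitySize {n k : ℕ} (Φ : Fin n → Fin k) (a : Fin k) : ℕ :=
  (Finset.univ.filter fun i => Φ i = a).card

/-- The minimum community size. -/
noncomputable def minSize {n k : ℕ} (Φ : Fin n → Fin k) : ℕ :=
  ⨅ a, communitySize Φ a

/-- The expected similarity between two distinct nodes of the communities `a` and `b`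
(see `integral_similarityMatrix`). -/
noncomputable def meanSimilarity (d : ℕ) {n k : ℕ} (p q : ℝ) (Φ : Fin n → Fin k) :
    Matrix (Fin k) (Fin k) ℝ :=
  Matrix.of fun a b =>
    if a = b then
      ((communitySize Φ a - 2).choose (d - 2) : ℝ) * (p - q) + ((n - 2).choose (d - 2) : ℝ) * q
    else ((n - 2).choose (d - 2) : ℝ) * q

/-- The minimum within-cluster similarity, the least diagonal entry of `meanSimilarity`. -/
noncomputable def pMinus (d : ℕ) {n k : ℕ} (p q : ℝ) (Φ : Fin n → Fin k) : ℝ :=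
  ⨅ a, meanSimilarity d p q Φ a a

/-- The maximum cross-cluster similarity. All off-diagonal entries of `meanSimilarity` are equal to
this number, which is also the convention when there is only one community. -/
noncomputable def qPlus (d n : ℕ) (q : ℝ) : ℝ :=
  ((n - 2).choose (d - 2) : ℝ) * q

/-- The entrywise inner product of two real matrices. -/
def matInner {n : ℕ} (M N : Matrix (Fin n) (Fin n) ℝ) : ℝ :=
  ∑ i, ∑ j, M i j * N i j

/-- The feasible region of the semidefinite program. -/
def sdpFeasible (n : ℕ) : Set (Matrix (Fin n) (Fin n) ℝ) :=
  {X | X.PosSemidef ∧ matInner 1 X = n ∧ ∀ i j, 0 ≤ X i j ∧ X i j ≤ 1}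

/-- The penalized objective `⟨A - lam 𝟏, X⟩`, where `𝟏` is the all-one matrix. -/
def sdpObjective {n : ℕ} (A : Matrix (Fin n) (Fin n) ℝ) (lam : ℝ)
    (X : Matrix (Fin n) (Fin n) ℝ) : ℝ :=
  matInner (A - lam • Matrix.of fun _ _ => (1 : ℝ)) X

/-- `X` is the unique optimal solution of the penalized semidefinite program that maximizes
`⟨A - lam 𝟏, X⟩` over the feasible region. -/
def IsUniqueSDPOptimum {n : ℕ} (A : Matrix (Fin n) (Fin n) ℝ) (lam : ℝ)
    (X : Matrix (Fin n) (Fin n) ℝ) : Prop :=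
  X ∈ sdpFeasible n ∧
    ∀ Y ∈ sdpFeasible n, Y ≠ X → sdpObjective A lam Y < sdpObjective A lam X

theorem card_edges_through {n d : ℕ} (S : Finset (Fin n)) {i j : Fin n} (hij : i ≠ j)
    (hi : i ∈ S) (hj : j ∈ S) (hd : 2 ≤ d) :
    (Finset.univ.filter fun e : Edge n d => (i ∈ e.1 ∧ j ∈ e.1) ∧ e.1 ⊆ S).card
      = (S.card - 2).choose (d - 2) := by
  have hc : ((S.erase i).erase j).card = S.card - 2 := by
    rw [Finset.card_erase_of_mem (by simp [hij.symm, hj]), Finset.card_erase_of_mem hi]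
    omega
  rw [← hc, ← Finset.card_powersetCard]
  refine Finset.card_bij' (fun e _ => (e.1.erase i).erase j)
    (fun t ht => ⟨insert i (insert j t), ?_⟩) ?_ ?_ ?_ ?_
  · rw [Finset.mem_powersetCard] at ht
    have h1 : j ∉ t := fun h => by simpa using ht.1 h
    have h2 : i ∉ insert j t := fun h => by
      rcases Finset.mem_insert.1 h with h | h
      · exact hij h
      · simpa using ht.1 h
    rw [Finset.card_insert_of_notMem h2, Finset.card_insert_of_notMem h1, ht.2]
    omega
  · intro e he
    simp only [Finset.mem_filter, Finset.mem_univ, true_and] at he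
    rw [Finset.mem_powersetCard]
    refine ⟨Finset.erase_subset_erase _ (Finset.erase_subset_erase _ he.2), ?_⟩
    rw [Finset.card_erase_of_mem (by simp [hij.symm, he.1.2]),
      Finset.card_erase_of_mem he.1.1, e.2]
    omega
  · intro t ht
    rw [Finset.mem_powersetCard] at ht
    simp only [Finset.mem_filter, Finset.mem_univ, true_and]
    refine ⟨by simp, ?_⟩
    intro x hx
    simp only [Finset.mem_insert] at hx
    rcases hx with rfl | rfl | hx
    · exact hi
    · exact hj
    · exact Finset.mem_of_mem_erase (Finset.mem_of_mem_erase (ht.1 hx))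
  · intro e he
    simp only [Finset.mem_filter, Finset.mem_univ, true_and] at he
    apply Subtype.ext
    ext x
    simp only [Finset.mem_insert, Finset.mem_erase]
    by_cases h1 : x = i
    · simp [h1, he.1.1]
    · by_cases h2 : x = j
      · simp [h2, he.1.2]
      · simp [h1, h2]
  · intro t ht
    rw [Finset.mem_powersetCard] at ht
    ext x
    simp only [Finset.mem_insert, Finset.mem_erase]
    constructor
    · rintro ⟨h1, h2, h3⟩
      tauto
    · intro hx
      have := ht.1 hx
      simp only [Finset.mem_erase] at this
      tauto

/-- The entries of `meanSimilarity` are the expectations of the off-diagonal entries of the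
similarity matrix. -/
theorem integral_similarityMatrix {Ω : Type*} [MeasurableSpace Ω] {μ : Measure Ω}
    [IsProbabilityMeasure μ] {n k d : ℕ} (hd : 2 ≤ d) {p q : ℝ} {Φ : Fin n → Fin k}
    {W : Edge n d → Ω → ℝ} (h : IsWHSBM μ p q Φ W) {i j : Fin n} (hij : i ≠ j) :
    ∫ ω, similarityMatrix (fun e => W e ω) i j ∂μ = meanSimilarity d p q Φ (Φ i) (Φ j) := by
  classical
  have hint : ∀ e, Integrable (W e) μ := fun e =>
    Integrable.of_mem_Icc 0 1 (h.measurable e).aemeasurable (h.weight_mem e)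
  simp only [similarityMatrix, Matrix.of_apply, hij, if_false]
  rw [integral_finsetSum _ fun e _ => hint e]
  have hmean : ∀ e, ∫ ω, W e ω ∂μ = q + if IsHomogeneous Φ e then (p - q) else 0 := by
    intro e
    split_ifs with he
    · rw [h.mean_homogeneous e he]; ring
    · rw [h.mean_heterogeneous e he]; ring
  simp only [hmean]
  have hall := card_edges_through (d := d) Finset.univ hij (by simp) (by simp) hd
  simp only [Finset.subset_univ, and_true, Finset.card_univ, Fintype.card_fin] at hall
  rw [Finset.sum_add_distrib, Finset.sum_const, hall, ← Finset.sum_filter, Finset.sum_const,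
    Finset.filter_filter, nsmul_eq_mul, nsmul_eq_mul]
  simp only [meanSimilarity, Matrix.of_apply]
  split_ifs with hΦ
  · have hS := card_edges_through (d := d) (Finset.univ.filter fun x => Φ x = Φ i) hij (by simp)
      (by simp [hΦ]) hd
    have heq : (Finset.univ.filter fun e : Edge n d =>
          (i ∈ e.1 ∧ j ∈ e.1) ∧ IsHomogeneous Φ e)
        = Finset.univ.filter fun e : Edge n d =>
          (i ∈ e.1 ∧ j ∈ e.1) ∧ e.1 ⊆ Finset.univ.filter fun x => Φ x = Φ i := by
      ext e
      simp only [Finset.mem_filter, Finset.mem_univ, true_and]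
      constructor
      · rintro ⟨h1, h2⟩
        exact ⟨h1, fun x hx => by simpa using h2 x hx i h1.1⟩
      · rintro ⟨h1, h2⟩
        refine ⟨h1, fun x hx y hy => ?_⟩
        have hx' := h2 hx
        have hy' := h2 hy
        simp only [Finset.mem_filter, Finset.mem_univ, true_and] at hx' hy'
        rw [hx', hy']
    rw [heq, hS, communitySize]
    ring
  · have heq : (Finset.univ.filter fun e : Edge n d =>
          (i ∈ e.1 ∧ j ∈ e.1) ∧ IsHomogeneous Φ e) = ∅ := by
      ext e
      simp only [Finset.mem_filter, Finset.mem_univ, true_and, Finset.notMem_empty, iff_false]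
      rintro ⟨h1, h2⟩
      exact hΦ (h2 i h1.1 j h1.2)
    rw [heq]
    simp

end HypergraphSBM

/-! Let `X` be the cluster matrix, `Y` another feasible point, `D = X - Y`, and write the similarity
matrix as its mean `E` (with diagonal zero) plus a noise matrix `N`. Trace `n` and entries at most 1
force the diagonal of `Y` to be 1, so `D` vanishes on the diagonal, is nonnegative inside
communities and nonpositive across them. With `gap = C(s_min-2, d-2)(p-q)`, the window for `lam`
puts `E - lam` at least `gap/4` on the right side of zero in both cases, so the signal `⟨E - lam 𝟏,
D⟩` is at least `gap/4` times the entrywise norm `‖D‖₁`.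

For the noise, let `P` be the projection onto the community indicators. Then `D = PD + DP - PDP - Z`
with `Z = (1-P)Y(1-P)` positive semidefinite and `tr Z = tr(PD) ≤ ‖D‖₁ / s_min`. The first three
terms are controlled by the community averages of `N`, the last by its largest eigenvalue. If the
averages are at most `gap/32` and the quadratic form of `N` at most `s_min * gap/32`, the noise
costs at most `gap/8 * ‖D‖₁` and `X` wins strictly (`isUniqueSDPOptimum_of_noise_le`).

Put `m = C(n-2, d-2) p`. The averages obey a Bernstein bound; this uses the term `s_min log n` of
the parameter condition. The eigenvalue bound must be of order `√(nm)` with no logarithmic factor;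
this uses the term `n`. It follows the Kahn–Szemerédi method (`measure_not_quadratic_le`): test
`xᵀNy` on a finite norming set, treat light pairs (small `|x i y j|`) by Bernstein, and heavy pairs
deterministically from degree and discrepancy bounds (`sum_heavy_le`). No trimming of large degrees
is needed because the parameter condition forces `nm ≥ log n`. Entries of the similarity matrix are
dependent, since one edge feeds many of them; every linear functional is therefore rewritten as a
sum over the independent edges, at the price of factors `d²`. -/

namespace HypergraphSBM

/-! ### Exponential tail bounds for independent bounded variables -/

/-- Chernoff's bound for a finite sum of bounded independent random variables. -/
theorem measure_sum_ge_le {Ω ι : Type*} [MeasurableSpace Ω] {μ : Measure Ω}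
    [IsProbabilityMeasure μ] [Fintype ι] {Y : ι → Ω → ℝ} (hm : ∀ e, Measurable (Y e))
    (hind : iIndepFun Y μ) (lo hi : ι → ℝ) (hb : ∀ e, ∀ᵐ ω ∂μ, Y e ω ∈ Set.Icc (lo e) (hi e))
    {b : ι → ℝ} (hmgf : ∀ e, ∫ ω, Real.exp (Y e ω) ∂μ ≤ Real.exp (b e)) (t : ℝ) :
    μ.real {ω | t ≤ ∑ e, Y e ω} ≤ Real.exp (∑ e, b e - t) := by
  have hsum : mgf (∑ e, Y e) μ 1 = ∏ e, mgf (Y e) μ 1 := hind.mgf_sum hm Finset.univ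
  have hprod : mgf (∑ e, Y e) μ 1 ≤ Real.exp (∑ e, b e) := by
    rw [hsum, Real.exp_sum]
    refine Finset.prod_le_prod (fun e _ => mgf_nonneg) fun e _ => ?_
    simpa [mgf] using hmgf e
  have hall : ∀ᵐ ω ∂μ, ∀ e, Y e ω ∈ Set.Icc (lo e) (hi e) := ae_all_iff.2 hb
  have hint : Integrable (fun ω => Real.exp (1 * (∑ e, Y e) ω)) μ := by
    refine integrable_exp_mul_of_mem_Icc (a := ∑ e, lo e) (b := ∑ e, hi e) ?_ ?_
    · have : Measurable (∑ e, Y e) := by fun_prop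
      exact this.aemeasurable
    · filter_upwards [hall] with ω hω
      rw [Finset.sum_apply]
      exact ⟨Finset.sum_le_sum fun e _ => (hω e).1, Finset.sum_le_sum fun e _ => (hω e).2⟩
  have h := measure_ge_le_exp_mul_mgf t zero_le_one hint
  simp only [Finset.sum_apply] at h
  refine h.trans ?_
  calc Real.exp (-1 * t) * mgf (∑ e, Y e) μ 1
      ≤ Real.exp (-1 * t) * Real.exp (∑ e, b e) :=
        mul_le_mul_of_nonneg_left hprod (Real.exp_pos _).le
    _ = Real.exp (∑ e, b e - t) := by rw [← Real.exp_add]; ring_nf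

/-- Bernstein-type tail bound for independent `[0,1]`-valued variables with means at most `p`. -/
theorem measure_centered_sum_ge_le {Ω ι : Type*} [MeasurableSpace Ω] {μ : Measure Ω}
    [IsProbabilityMeasure μ] [Fintype ι] {W : ι → Ω → ℝ} (hm : ∀ e, Measurable (W e))
    (hind : iIndepFun W μ) (hb : ∀ e, ∀ᵐ ω ∂μ, W e ω ∈ Set.Icc (0 : ℝ) 1)
    {p : ℝ} (hp : ∀ e, ∫ ω, W e ω ∂μ ≤ p) {c : ι → ℝ} (hc : ∀ e, |c e| ≤ 1) (t : ℝ) :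
    μ.real {ω | t ≤ ∑ e, c e * (W e ω - ∫ ω', W e ω' ∂μ)} ≤
      Real.exp (p * ∑ e, c e ^ 2 - t) := by
  have hint : ∀ e, Integrable (W e) μ := fun e =>
    Integrable.of_mem_Icc 0 1 (hm e).aemeasurable (hb e)
  have hmean : ∀ e, ∫ ω, W e ω ∂μ ∈ Set.Icc (0 : ℝ) 1 := by
    intro e
    constructor
    · exact integral_nonneg_of_ae ((hb e).mono fun ω h => h.1)
    · calc ∫ ω, W e ω ∂μ ≤ ∫ _, (1 : ℝ) ∂μ :=
            integral_mono_ae (hint e) (integrable_const _) ((hb e).mono fun ω h => h.2)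
        _ = 1 := by simp
  rw [Finset.mul_sum]
  refine measure_sum_ge_le (Y := fun e ω => c e * (W e ω - ∫ ω', W e ω' ∂μ))
    (fun e => ((hm e).sub_const _).const_mul _) ?_ (fun _ => -1) (fun _ => 1) ?_ ?_ t
  · exact hind.comp (fun e x => c e * (x - ∫ ω', W e ω' ∂μ))
      (fun e => (measurable_id.sub_const _).const_mul _)
  · intro e
    filter_upwards [hb e] with ω hω
    rw [Set.mem_Icc, ← abs_le, abs_mul]
    have h1 : |W e ω - ∫ ω', W e ω' ∂μ| ≤ 1 := by
      rw [abs_le]; constructor <;> linarith [hω.1, hω.2, (hmean e).1, (hmean e).2]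
    exact mul_le_one₀ (hc e) (abs_nonneg _) h1
  · intro e
    set M := ∫ ω', W e ω' ∂μ with hM
    have hbd : ∀ᵐ ω ∂μ, Real.exp (c e * (W e ω - M)) ≤
        1 + c e * (W e ω - M) + c e ^ 2 * (W e ω - M) ^ 2 := by
      filter_upwards [hb e] with ω hω
      have h1 : |W e ω - M| ≤ 1 := by
        rw [abs_le]; constructor <;> linarith [hω.1, hω.2, (hmean e).1, (hmean e).2]
      have h2 : |c e * (W e ω - M)| ≤ 1 := by
        rw [abs_mul]; exact mul_le_one₀ (hc e) (abs_nonneg _) h1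
      have h3 := (abs_le.1 (Real.abs_exp_sub_one_sub_id_le h2)).2
      nlinarith
    -- Since `W² ≤ W` on `[0,1]`, the quadratic bound becomes affine in `W`, so its integral depends
    -- on the mean alone.
    have hbd' : ∀ᵐ ω ∂μ, Real.exp (c e * (W e ω - M)) ≤
        1 + c e * (W e ω - M) + c e ^ 2 * (W e ω - 2 * M * W e ω + M ^ 2) := by
      filter_upwards [hb e, hbd] with ω hω h
      refine h.trans ?_
      have : (W e ω - M) ^ 2 ≤ W e ω - 2 * M * W e ω + M ^ 2 := by nlinarith [hω.1, hω.2]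
      nlinarith [sq_nonneg (c e)]
    have hi1 : Integrable (fun ω => 1 + c e * (W e ω - M) +
        c e ^ 2 * (W e ω - 2 * M * W e ω + M ^ 2)) μ :=
      ((integrable_const _).add (((hint e).sub (integrable_const _)).const_mul _)).add
        ((((hint e).sub ((hint e).const_mul _)).add (integrable_const _)).const_mul _)
    have hi0 : Integrable (fun ω => Real.exp (c e * (W e ω - M))) μ := by
      refine Integrable.of_mem_Icc 0 (Real.exp 1) (((hm e).sub_const _).const_mul _).exp.aemeasurable ?_
      filter_upwards [hb e] with ω hω
      refine ⟨(Real.exp_pos _).le, Real.exp_le_exp.2 ?_⟩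
      have h1 : |W e ω - M| ≤ 1 := by
        rw [abs_le]; constructor <;> linarith [hω.1, hω.2, (hmean e).1, (hmean e).2]
      refine (le_abs_self _).trans ?_
      rw [abs_mul]; exact mul_le_one₀ (hc e) (abs_nonneg _) h1
    have hev : ∫ ω, (1 + c e * (W e ω - M) +
        c e ^ 2 * (W e ω - 2 * M * W e ω + M ^ 2)) ∂μ = 1 + c e ^ 2 * (M - M ^ 2) := by
      have : ∀ ω, 1 + c e * (W e ω - M) + c e ^ 2 * (W e ω - 2 * M * W e ω + M ^ 2)
          = (c e + c e ^ 2 * (1 - 2 * M)) * W e ω + (1 - c e * M + c e ^ 2 * M ^ 2) := by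
        intro ω; ring
      simp only [this]
      rw [integral_add ((hint e).const_mul _) (integrable_const _), integral_const_mul, ← hM]
      simp
      ring
    calc ∫ ω, Real.exp (c e * (W e ω - M)) ∂μ ≤ 1 + c e ^ 2 * (M - M ^ 2) := by
          rw [← hev]; exact integral_mono_ae hi0 hi1 hbd'
      _ ≤ 1 + p * c e ^ 2 := by
          nlinarith [sq_nonneg (c e), mul_nonneg (sq_nonneg (c e)) (sq_nonneg M),
            mul_le_mul_of_nonneg_left (hp e) (sq_nonneg (c e))]
      _ ≤ Real.exp (p * c e ^ 2) := by linarith [Real.add_one_le_exp (p * c e ^ 2)]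

/-- Chernoff-type upper tail bound for independent `[0,1]`-valued variables with means at most
`p`. -/
theorem measure_weighted_sum_ge_le {Ω ι : Type*} [MeasurableSpace Ω] {μ : Measure Ω}
    [IsProbabilityMeasure μ] [Fintype ι] {W : ι → Ω → ℝ} (hm : ∀ e, Measurable (W e))
    (hind : iIndepFun W μ) (hb : ∀ e, ∀ᵐ ω ∂μ, W e ω ∈ Set.Icc (0 : ℝ) 1)
    {p : ℝ} (hp : ∀ e, ∫ ω, W e ω ∂μ ≤ p) {u : ι → ℝ} (hu : ∀ e, u e ∈ Set.Icc (0 : ℝ) 1)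
    {θ : ℝ} (hθ : 0 ≤ θ) (t : ℝ) :
    μ.real {ω | t ≤ θ * ∑ e, u e * W e ω} ≤
      Real.exp (p * (Real.exp θ - 1) * ∑ e, u e - t) := by
  have hint : ∀ e, Integrable (W e) μ := fun e =>
    Integrable.of_mem_Icc 0 1 (hm e).aemeasurable (hb e)
  have he1 : 0 ≤ Real.exp θ - 1 := by linarith [Real.add_one_le_exp θ]
  simp only [Finset.mul_sum]
  refine measure_sum_ge_le (Y := fun e ω => θ * (u e * W e ω))
    (fun e => ((hm e).const_mul _).const_mul _) ?_ (fun _ => 0) (fun _ => θ) ?_ ?_ t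
  · exact hind.comp (fun e x => θ * (u e * x))
      (fun e => (measurable_id.const_mul _).const_mul _)
  · intro e
    filter_upwards [hb e] with ω hω
    exact ⟨mul_nonneg hθ (mul_nonneg (hu e).1 hω.1),
      mul_le_of_le_one_right hθ (mul_le_one₀ (hu e).2 hω.1 hω.2)⟩
  · intro e
    -- By convexity, `exp` lies below its chord over `[0, θ]`.
    have hbd : ∀ᵐ ω ∂μ, Real.exp (θ * (u e * W e ω)) ≤ 1 + (Real.exp θ - 1) * u e * W e ω := by
      filter_upwards [hb e] with ω hω
      have hz0 : 0 ≤ u e * W e ω := mul_nonneg (hu e).1 hω.1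
      have hz1 : u e * W e ω ≤ 1 := mul_le_one₀ (hu e).2 hω.1 hω.2
      have := convexOn_exp.2 (Set.mem_univ (0 : ℝ)) (Set.mem_univ θ)
        (sub_nonneg.2 hz1) hz0 (by ring)
      simp only [smul_eq_mul, mul_zero, zero_add, Real.exp_zero] at this
      rw [mul_comm θ]
      linarith
    have hi0 : Integrable (fun ω => Real.exp (θ * (u e * W e ω))) μ := by
      refine Integrable.of_mem_Icc 0 (Real.exp θ)
        (((hm e).const_mul _).const_mul _).exp.aemeasurable ?_
      filter_upwards [hb e] with ω hω
      exact ⟨(Real.exp_pos _).le, Real.exp_le_exp.2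
        (mul_le_of_le_one_right hθ (mul_le_one₀ (hu e).2 hω.1 hω.2))⟩
    calc ∫ ω, Real.exp (θ * (u e * W e ω)) ∂μ
        ≤ ∫ ω, (1 + (Real.exp θ - 1) * u e * W e ω) ∂μ :=
          integral_mono_ae hi0 ((integrable_const _).add ((hint e).const_mul _)) hbd
      _ = 1 + (Real.exp θ - 1) * u e * ∫ ω, W e ω ∂μ := by
          rw [integral_add (integrable_const _) ((hint e).const_mul _), integral_const_mul]
          simp
      _ ≤ 1 + p * (Real.exp θ - 1) * u e := by
          nlinarith [mul_le_mul_of_nonneg_left (hp e) (mul_nonneg he1 (hu e).1)]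
      _ ≤ _ := by linarith [Real.add_one_le_exp (p * (Real.exp θ - 1) * u e)]

/-! ### From pairs of nodes to independent edges -/

/-- The sum of `c i j` over the ordered pairs of distinct nodes of the edge `e`. -/
def edgeSum {n d : ℕ} (c : Fin n → Fin n → ℝ) (e : Edge n d) : ℝ :=
  ∑ i ∈ e.1, ∑ j ∈ e.1, if i = j then 0 else c i j

theorem edgeSum_eq_univ {n d : ℕ} (c : Fin n → Fin n → ℝ) (e : Edge n d) :
    edgeSum c e = ∑ i, ∑ j, if i ∈ e.1 ∧ j ∈ e.1 then (if i = j then 0 else c i j) else 0 := by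
  unfold edgeSum
  rw [← Finset.sum_subset (Finset.subset_univ e.1)]
  · refine Finset.sum_congr rfl fun i hi => ?_
    rw [← Finset.sum_subset (Finset.subset_univ e.1)]
    · exact Finset.sum_congr rfl fun j hj => (if_pos (And.intro hi hj)).symm
    · intro j _ hj
      rw [if_neg fun h => hj h.2]
  · intro i _ hi
    exact Finset.sum_eq_zero fun j _ => by rw [if_neg fun h => hi h.1]

/-- Exchanging the sums turns a linear functional of the dependent matrix entries into a sum of
independent edge weights, to which Chernoff bounds apply. -/
theorem sum_mul_similarityMatrix {n d : ℕ} (c : Fin n → Fin n → ℝ) (w : Edge n d → ℝ) :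
    ∑ i, ∑ j, c i j * similarityMatrix w i j = ∑ e, edgeSum c e * w e := by
  simp only [edgeSum_eq_univ, Finset.sum_mul]
  rw [Finset.sum_comm]
  refine (Finset.sum_congr rfl fun i _ => Finset.sum_congr rfl fun j _ => ?_).trans
    ((Finset.sum_congr rfl fun i _ => Finset.sum_comm).trans (Finset.sum_comm.trans
      (Finset.sum_congr rfl fun e _ => Finset.sum_comm)))
  simp only [similarityMatrix, Matrix.of_apply]
  by_cases h : j = i
  · simp [h]
  · rw [if_neg h, Finset.sum_filter, Finset.mul_sum]
    refine Finset.sum_congr rfl fun e _ => ?_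
    by_cases h2 : j ∈ e.1 ∧ i ∈ e.1 <;> simp [h, h2]

theorem similarityMatrix_symm {n d : ℕ} (w : Edge n d → ℝ) (i j : Fin n) :
    similarityMatrix w i j = similarityMatrix w j i := by
  simp only [similarityMatrix, Matrix.of_apply, eq_comm (a := i), and_comm (a := i ∈ _)]

theorem similarityMatrix_const {n d : ℕ} (hd : 2 ≤ d) (a : ℝ) (i j : Fin n) :
    similarityMatrix (fun _ : Edge n d => a) i j =
      if i = j then 0 else ((n - 2).choose (d - 2) : ℝ) * a := by
  simp only [similarityMatrix, Matrix.of_apply]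
  split_ifs with h
  · rfl
  · have hall := card_edges_through (d := d) Finset.univ h (by simp) (by simp) hd
    simp only [Finset.subset_univ, and_true, Finset.card_univ, Fintype.card_fin] at hall
    rw [Finset.sum_const, hall, nsmul_eq_mul]

theorem similarityMatrix_mono {n d : ℕ} {w w' : Edge n d → ℝ} (h : ∀ e, w e ≤ w' e)
    (i j : Fin n) : similarityMatrix w i j ≤ similarityMatrix w' i j := by
  simp only [similarityMatrix, Matrix.of_apply]
  split_ifs
  · rfl
  · exact Finset.sum_le_sum fun e _ => h e

theorem similarityMatrix_nonneg {n d : ℕ} {w : Edge n d → ℝ} (h : ∀ e, 0 ≤ w e)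
    (i j : Fin n) : 0 ≤ similarityMatrix w i j := by
  simp only [similarityMatrix, Matrix.of_apply]
  split_ifs
  · rfl
  · exact Finset.sum_nonneg fun e _ => h e

theorem similarityMatrix_sub {n d : ℕ} (w w' : Edge n d → ℝ) :
    similarityMatrix w - similarityMatrix w' = similarityMatrix fun e => w e - w' e := by
  ext i j
  simp only [similarityMatrix, Matrix.of_apply, Matrix.sub_apply]
  split_ifs
  · simp
  · rw [Finset.sum_sub_distrib]

/-- Unit weights make every off-diagonal similarity equal to the number of edges through a pair. The
inequality only absorbs the diagonal of `c`. -/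
theorem sum_edgeSum_le {n d : ℕ} (hd : 2 ≤ d) {c : Fin n → Fin n → ℝ} (hc : ∀ i j, 0 ≤ c i j) :
    ∑ e : Edge n d, edgeSum c e ≤ ((n - 2).choose (d - 2) : ℝ) * ∑ i, ∑ j, c i j := by
  have h := sum_mul_similarityMatrix c (fun _ : Edge n d => (1 : ℝ))
  simp only [mul_one, similarityMatrix_const hd] at h
  rw [← h, Finset.mul_sum]
  refine Finset.sum_le_sum fun i _ => ?_
  rw [Finset.mul_sum]
  refine Finset.sum_le_sum fun j _ => ?_
  split_ifs
  · rw [mul_zero]; exact mul_nonneg (Nat.cast_nonneg _) (hc i j)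
  · rw [mul_comm]

theorem edgeSum_nonneg {n d : ℕ} {c : Fin n → Fin n → ℝ} (hc : ∀ i j, 0 ≤ c i j)
    (e : Edge n d) : 0 ≤ edgeSum c e :=
  Finset.sum_nonneg fun i _ => Finset.sum_nonneg fun j _ => by split_ifs; exacts [le_rfl, hc i j]

theorem abs_edgeSum_le {n d : ℕ} {c : Fin n → Fin n → ℝ} {τ : ℝ} (hτ : 0 ≤ τ)
    (hc : ∀ i j, |c i j| ≤ τ) (e : Edge n d) : |edgeSum c e| ≤ (d : ℝ) ^ 2 * τ := by
  calc |edgeSum c e| ≤ ∑ i ∈ e.1, |∑ j ∈ e.1, if i = j then 0 else c i j| :=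
        Finset.abs_sum_le_sum_abs _ _
    _ ≤ ∑ i ∈ e.1, ∑ j ∈ e.1, τ := by
        refine Finset.sum_le_sum fun i _ => (Finset.abs_sum_le_sum_abs _ _).trans
          (Finset.sum_le_sum fun j _ => ?_)
        split_ifs
        · simpa using hτ
        · exact hc i j
    _ = (d : ℝ) ^ 2 * τ := by simp [e.2]; ring

/-- Cauchy–Schwarz over the `d²` ordered pairs of an edge. Together with `sum_edgeSum_le` it bounds
the variance of a linear functional. -/
theorem edgeSum_sq_le {n d : ℕ} (c : Fin n → Fin n → ℝ) (e : Edge n d) :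
    edgeSum c e ^ 2 ≤ (d : ℝ) ^ 2 * edgeSum (fun i j => c i j ^ 2) e := by
  unfold edgeSum
  rw [← Finset.sum_product', ← Finset.sum_product']
  refine sq_sum_le_card_mul_sum_sq.trans ?_
  rw [Finset.card_product, e.2]
  push_cast
  rw [← pow_two]
  refine mul_le_mul_of_nonneg_left (Finset.sum_le_sum fun x _ => ?_) (by positivity)
  split_ifs <;> simp

/-! ### Heavy pairs: clipped geometric sums and the Kahn–Szemerédi estimate -/

/-- `x` if `x ≤ 1`, and zero otherwise. -/
noncomputable def clip (x : ℝ) : ℝ := if x ≤ 1 then x else 0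

theorem clip_of_le {x : ℝ} (h : x ≤ 1) : clip x = x := if_pos h

theorem clip_nonneg {x : ℝ} (h : 0 ≤ x) : 0 ≤ clip x := by
  unfold clip; split_ifs <;> simp [h]

/-- Only terms at most 1 survive the clipping, and an increasing geometric sum is dominated by its
last surviving term; hence a bound free of `c` and `R`. -/
theorem sum_clip_geom_le_of_one_lt {c r : ℝ} (hc : 0 ≤ c) (hr : 1 < r) (R : ℕ) :
    ∑ k ∈ Finset.range R, clip (c * r ^ k) ≤ r / (r - 1) := by
  have hr' : 0 < r - 1 := by linarith
  have key : ∀ R : ℕ, ∑ k ∈ Finset.range R, clip (c * r ^ k) ≤ c * r ^ R / (r - 1) := by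
    intro R
    induction R with
    | zero => simp; positivity
    | succ R ih =>
      rw [Finset.sum_range_succ]
      have h1 : clip (c * r ^ R) ≤ c * r ^ R := by
        unfold clip; split_ifs
        · rfl
        · positivity
      calc _ ≤ c * r ^ R / (r - 1) + c * r ^ R := add_le_add ih h1
        _ = c * r ^ (R + 1) / (r - 1) := by field_simp; ring
  induction R with
  | zero => simp; positivity
  | succ R ih =>
    by_cases h : c * r ^ R ≤ 1
    · refine (key (R + 1)).trans ?_
      rw [pow_succ, ← mul_assoc]
      gcongr
      nlinarith
    · rw [Finset.sum_range_succ]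
      simp only [clip, if_neg h, add_zero]
      exact ih

/-- Mirror image of the increasing case: the first surviving term dominates, so the induction peels
terms off the front and moves the factor `r` into `c`. -/
theorem sum_clip_geom_le_of_lt_one {c r : ℝ} (hc : 0 ≤ c) (hr0 : 0 < r) (hr : r < 1) (R : ℕ) :
    ∑ k ∈ Finset.range R, clip (c * r ^ k) ≤ 1 / (1 - r) := by
  have hr' : 0 < 1 - r := by linarith
  have key : ∀ (R : ℕ) (c : ℝ), 0 ≤ c →
      ∑ k ∈ Finset.range R, clip (c * r ^ k) ≤ c / (1 - r) := by
    intro R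
    induction R with
    | zero => intro c hc; simp; positivity
    | succ R ih =>
      intro c hc
      rw [Finset.sum_range_succ']
      have h1 : clip (c * r ^ 0) ≤ c := by
        rw [pow_zero, mul_one]
        unfold clip; split_ifs
        · rfl
        · positivity
      have h2 := ih (c * r) (by positivity)
      have h3 : ∀ k, c * r ^ (k + 1) = c * r * r ^ k := fun k => by ring
      simp only [h3]
      calc _ ≤ c * r / (1 - r) + c := add_le_add h2 h1
        _ = c / (1 - r) := by field_simp; ring
  induction R generalizing c with
  | zero => simp; linarith
  | succ R ih =>
    by_cases h : c ≤ 1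
    · exact (key (R + 1) c hc).trans (div_le_div_of_nonneg_right h hr'.le)
    · rw [Finset.sum_range_succ']
      have h3 : ∀ k, c * r ^ (k + 1) = c * r * r ^ k := fun k => by ring
      simp only [h3, pow_zero, mul_one]
      have : clip c = 0 := if_neg h
      rw [this, add_zero]
      exact ih (by positivity)

theorem sum_clip_div_two_pow_le {c : ℝ} (hc : 0 ≤ c) (R : ℕ) :
    ∑ k ∈ Finset.range R, clip (c * (1 / 2) ^ k) ≤ 2 := by
  have := sum_clip_geom_le_of_lt_one hc (by norm_num : (0 : ℝ) < 1 / 2) (by norm_num) R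
  norm_num at this ⊢
  exact this

theorem sum_clip_div_half_pow_le {c : ℝ} (hc : 0 ≤ c) (R : ℕ) :
    ∑ k ∈ Finset.range R, clip (c / (1 / 2) ^ k) ≤ 2 := by
  have := sum_clip_geom_le_of_one_lt hc (by norm_num : (1 : ℝ) < 2) R
  have h2 : ∀ k : ℕ, c / (1 / 2) ^ k = c * 2 ^ k := fun k => by simp [div_eq_mul_inv]
  simp only [h2]
  norm_num at this
  exact this

theorem sum_clip_sqrt_mul_half_pow_le {c : ℝ} (hc : 0 ≤ c) (R : ℕ) :
    ∑ k ∈ Finset.range R, clip (√(c * (1 / 2) ^ k)) ≤ 4 := by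
  have h3 : √(1 / 2 : ℝ) ≤ 3 / 4 := by
    rw [Real.sqrt_le_left (by norm_num)]; norm_num
  have h0 : 0 < √(1 / 2 : ℝ) := Real.sqrt_pos.2 (by norm_num)
  have := sum_clip_geom_le_of_lt_one (Real.sqrt_nonneg c) h0 (by linarith) R
  have h4 : ∀ k : ℕ, √(c * (1 / 2) ^ k) = √c * √(1 / 2) ^ k := by
    intro k
    rw [Real.sqrt_mul hc]
    congr 1
    rw [Real.sqrt_eq_iff_mul_self_eq (by positivity) (by positivity), ← mul_pow,
      Real.mul_self_sqrt (by norm_num)]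
  simp only [h4]
  refine this.trans ?_
  rw [div_le_iff₀ (by linarith)]
  linarith

/-- The logarithm of `1/z` is absorbed by `z log(1/z) ≤ 2√z`. The other logarithms are bounded by
`θ`, which cancels later against the factor `θ` in the discrepancy property. -/
theorem mul_log_le {z x y θ : ℝ} (hz : 0 < z) (hz1 : z ≤ 1) (hx : x ≤ θ) (hy : y ≤ θ)
    (hθ : 1 ≤ θ) : z * (1 + x + Real.log (1 / z) + y) ≤ 5 * √z * θ := by
  have hs : 0 < √z := Real.sqrt_pos.2 hz
  have hss : √z * √z = z := Real.mul_self_sqrt hz.le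
  have hs1 : √z ≤ 1 := Real.sqrt_le_one.2 hz1
  have hzs : z ≤ √z := by nlinarith
  have l3 : z * Real.log (1 / z) ≤ 2 * √z := by
    have h4 : Real.log (1 / z) = 2 * Real.log (1 / √z) := by
      simp only [one_div, Real.log_inv, Real.log_sqrt hz.le]; ring
    have h5 : Real.log (1 / √z) ≤ 1 / √z :=
      (Real.log_le_sub_one_of_pos (by positivity)).trans (by linarith)
    rw [h4]
    calc z * (2 * Real.log (1 / √z)) ≤ z * (2 * (1 / √z)) := by gcongr
      _ = √z * √z * (2 * (1 / √z)) := by rw [hss]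
      _ = 2 * √z := by field_simp
  have l4 : z * (1 + x + y) ≤ √z * (3 * θ) := by
    calc _ ≤ z * (3 * θ) := mul_le_mul_of_nonneg_left (by linarith) hz.le
      _ ≤ _ := mul_le_mul_of_nonneg_right hzs (by linarith)
  have l5 : 2 * √z ≤ 2 * √z * θ := le_mul_of_one_le_right (by positivity) hθ
  linarith

set_option maxHeartbeats 1000000 in
/-- Contribution of one pair of level sets, of sizes `a` and `b` and heights `α` and `β`, under
the degree bounds and the discrepancy property. -/
theorem level_pair_le {n : ℕ} {L κ a b α β E : ℝ} (hL : 1 ≤ L) (hκ : 0 ≤ κ) (ha : 1 ≤ a)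
    (hb : 1 ≤ b) (hα0 : 0 < α) (hα1 : α ≤ 1) (hβ0 : 0 < β) (hβ1 : β ≤ 1)
    (hn : 0 < n) (hg : Real.exp 1 * L < n * α * β)
    (hdega : E ≤ κ * a * L ^ 2) (hdegb : E ≤ κ * b * L ^ 2)
    (hdisc : ∀ θ : ℕ, 1 ≤ θ → θ ≤ 3 * n → θ * E ≤ κ * (L ^ 2 / n * a * b * Real.exp θ +
      a * Real.log (Real.exp 1 * n / a) + b * Real.log (Real.exp 1 * n / b))) :
    α * β * E ≤ κ * L * (3 * (a * α ^ 2 * (b * β ^ 2)) +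
      3 * (a * α ^ 2 + b * β ^ 2) * clip (L / (n * α * β)) +
      5 * (b * β ^ 2) * clip (√(α / (β * L))) + 5 * (a * α ^ 2) * clip (√(β / (α * L))) +
      a * α ^ 2 * clip (β * L / α) + b * β ^ 2 * clip (α * L / β)) := by
  have hL0 : 0 < L := by linarith
  have ha0 : 0 < a := by linarith
  have hb0 : 0 < b := by linarith
  have hnR : (1 : ℝ) ≤ n := by exact_mod_cast hn
  have hn0 : (0 : ℝ) < n := by linarith
  -- `u` and `v` are the squared masses of the two levels, `g` measures how far the pair exceeds the
  -- heaviness scale, and `ρ`, `ρ'` compare the heights.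
  obtain ⟨u, hu⟩ : ∃ u, u = a * α ^ 2 := ⟨_, rfl⟩
  obtain ⟨v, hv⟩ : ∃ v, v = b * β ^ 2 := ⟨_, rfl⟩
  obtain ⟨g, hgdef⟩ : ∃ g, g = n * α * β / L := ⟨_, rfl⟩
  obtain ⟨ρ, hρ⟩ : ∃ ρ, ρ = α / (β * L) := ⟨_, rfl⟩
  obtain ⟨ρ', hρ'⟩ : ∃ ρ', ρ' = β / (α * L) := ⟨_, rfl⟩
  have hu0 : 0 < u := by rw [hu]; positivity
  have hv0 : 0 < v := by rw [hv]; positivity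
  have hρ0 : 0 < ρ := by rw [hρ]; positivity
  have hρ'0 : 0 < ρ' := by rw [hρ']; positivity
  have hge : Real.exp 1 ≤ g := by
    rw [hgdef, le_div_iff₀ hL0]; exact hg.le
  have hg1 : 1 ≤ g := le_trans (by linarith [Real.add_one_le_exp 1]) hge
  have hg0 : 0 < g := by linarith
  have e1 : L / (n * α * β) = 1 / g := by rw [hgdef]; field_simp
  have e2 : β * L / α = 1 / ρ := by rw [hρ]; field_simp
  have e3 : α * L / β = 1 / ρ' := by rw [hρ']; field_simp
  rw [e1, e2, e3, ← hu, ← hv, ← hρ, ← hρ']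
  have t1 : 0 ≤ u * v := by positivity
  have t2 : 0 ≤ (u + v) * clip (1 / g) := mul_nonneg (by positivity) (clip_nonneg (by positivity))
  have t3 : 0 ≤ v * clip (√ρ) := mul_nonneg hv0.le (clip_nonneg (by positivity))
  have t4 : 0 ≤ u * clip (√ρ') := mul_nonneg hu0.le (clip_nonneg (by positivity))
  have t5 : 0 ≤ u * clip (1 / ρ) := mul_nonneg hu0.le (clip_nonneg (by positivity))
  have t6 : 0 ≤ v * clip (1 / ρ') := mul_nonneg hv0.le (clip_nonneg (by positivity))
  have hκL : 0 ≤ κ * L := by positivity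
  -- When one height exceeds the other by more than a factor `L`, the degree bound alone suffices.
  -- Discrepancy is needed only for comparable heights.
  rcases lt_or_ge 1 ρ with h1 | h1
  · calc α * β * E ≤ α * β * (κ * a * L ^ 2) := by gcongr
      _ = κ * L * (u * clip (1 / ρ)) := by
        rw [clip_of_le (by rw [div_le_one hρ0]; exact h1.le), hu, hρ]; field_simp
      _ ≤ _ := mul_le_mul_of_nonneg_left (by linarith) hκL
  rcases lt_or_ge 1 ρ' with h2 | h2
  · calc α * β * E ≤ α * β * (κ * b * L ^ 2) := by gcongr
      _ = κ * L * (v * clip (1 / ρ')) := by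
        rw [clip_of_le (by rw [div_le_one hρ'0]; exact h2.le), hv, hρ']; field_simp
      _ ≤ _ := mul_le_mul_of_nonneg_left (by linarith) hκL
  rw [clip_of_le (Real.sqrt_le_one.2 h1),
    clip_of_le (Real.sqrt_le_one.2 h2),
    clip_of_le (by rw [div_le_one hg0]; exact hg1 : 1 / g ≤ 1)]
  -- `θ = ⌈log M⌉` dominates `log g`, `log (1/u)` and `log (1/v)`, while `e^θ ≤ 3M` stays within a
  -- constant of `g + 1/u + 1/v`.
  set M := max g (max (1 / u) (1 / v)) with hM
  have hMg : g ≤ M := le_max_left _ _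
  have hMu : 1 / u ≤ M := (le_max_left _ _).trans (le_max_right _ _)
  have hMv : 1 / v ≤ M := (le_max_right _ _).trans (le_max_right _ _)
  have hM0 : 0 < M := by linarith
  have hMsum : M ≤ g + 1 / u + 1 / v := by
    have : 0 < 1 / u := by positivity
    have : 0 < 1 / v := by positivity
    refine max_le (by linarith) (max_le (by linarith) (by linarith))
  -- Heaviness bounds the heights below, whence `M ≤ n²` and `θ ≤ 3n`: only finitely many values of
  -- `θ` enter the union bound.
  have hαβ : 1 ≤ n * (α * β) := by
    have h5 : 1 ≤ Real.exp 1 := by linarith [Real.add_one_le_exp 1]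
    have h6 := one_le_mul_of_one_le_of_one_le h5 hL
    rw [← mul_assoc]; linarith
  have hnα : 1 ≤ n * α := by
    have : n * (α * β) ≤ n * α := by
      have := mul_le_mul_of_nonneg_left hβ1 (by positivity : 0 ≤ n * α)
      linarith
    linarith
  have hnβ : 1 ≤ n * β := by
    have : n * (α * β) ≤ n * β := by
      have := mul_le_mul_of_nonneg_left hα1 (by positivity : 0 ≤ n * β)
      linarith
    linarith
  have hMn : M ≤ (n : ℝ) ^ 2 := by
    refine max_le ?_ (max_le ?_ ?_)
    · rw [hgdef, div_le_iff₀ hL0, mul_assoc]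
      calc n * (α * β) ≤ n * 1 :=
            mul_le_mul_of_nonneg_left (mul_le_one₀ hα1 hβ0.le hβ1) hn0.le
        _ ≤ n ^ 2 := by rw [mul_one]; exact le_self_pow₀ hnR two_ne_zero
        _ ≤ n ^ 2 * L := le_mul_of_one_le_right (by positivity) hL
    · rw [div_le_iff₀ hu0, hu]
      calc (1 : ℝ) ≤ a * (n * α) ^ 2 := one_le_mul_of_one_le_of_one_le ha (one_le_pow₀ hnα)
        _ = _ := by ring
    · rw [div_le_iff₀ hv0, hv]
      calc (1 : ℝ) ≤ b * (n * β) ^ 2 := one_le_mul_of_one_le_of_one_le hb (one_le_pow₀ hnβ)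
        _ = _ := by ring
  have hlogM : 1 ≤ Real.log M := by
    rw [Real.le_log_iff_exp_le hM0]; exact hge.trans hMg
  obtain ⟨θ, hθ⟩ : ∃ θ, θ = ⌈Real.log M⌉₊ := ⟨_, rfl⟩
  have hθlog : Real.log M ≤ θ := by rw [hθ]; exact Nat.le_ceil _
  have hθR : (1 : ℝ) ≤ θ := hlogM.trans hθlog
  have hθlt : (θ : ℝ) < Real.log M + 1 := by
    rw [hθ]; exact Nat.ceil_lt_add_one (by linarith)
  have hθn : θ ≤ 3 * n := by
    have h5 : Real.log M ≤ 2 * Real.log n := by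
      have := Real.log_le_log hM0 hMn
      rwa [Real.log_pow, Nat.cast_ofNat] at this
    have h6 := Real.log_le_sub_one_of_pos hn0
    have : (θ : ℝ) ≤ ((3 * n : ℕ) : ℝ) := by push_cast; linarith
    exact_mod_cast this
  have hexpθ : Real.exp θ ≤ 3 * M := by
    calc Real.exp θ ≤ Real.exp (Real.log M + 1) := Real.exp_le_exp.2 hθlt.le
      _ = M * Real.exp 1 := by rw [Real.exp_add, Real.exp_log hM0]
      _ ≤ M * 3 := by gcongr; linarith [Real.exp_one_lt_d9]
      _ = 3 * M := by ring
  have hd := hdisc θ (by exact_mod_cast hθR) hθn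
  have hlogb : Real.log (Real.exp 1 * n / b) =
      1 + Real.log g + Real.log (1 / ρ) + Real.log (1 / v) := by
    have : Real.exp 1 * n / b = Real.exp 1 * g * (1 / ρ) * (1 / v) := by
      rw [hgdef, hρ, hv]; field_simp
    rw [this, Real.log_mul (by positivity) (by positivity),
      Real.log_mul (by positivity) (by positivity), Real.log_mul (by positivity) (by positivity),
      Real.log_exp]
  have hloga : Real.log (Real.exp 1 * n / a) =
      1 + Real.log g + Real.log (1 / ρ') + Real.log (1 / u) := by
    have : Real.exp 1 * n / a = Real.exp 1 * g * (1 / ρ') * (1 / u) := by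
      rw [hgdef, hρ', hu]; field_simp
    rw [this, Real.log_mul (by positivity) (by positivity),
      Real.log_mul (by positivity) (by positivity), Real.log_mul (by positivity) (by positivity),
      Real.log_exp]
  have b1 := mul_log_le hρ0 h1 ((Real.log_le_log hg0 hMg).trans hθlog)
    ((Real.log_le_log (by positivity) hMv).trans hθlog) hθR
  have b2 := mul_log_le hρ'0 h2 ((Real.log_le_log hg0 hMg).trans hθlog)
    ((Real.log_le_log (by positivity) hMu).trans hθlog) hθR
  rw [← hlogb] at b1
  rw [← hloga] at b2
  have f1 : L ^ 2 / n * a * b * Real.exp θ * (α * β) ≤ L * (3 * (u * v) + 3 * (u + v) * (1 / g)) := by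
    calc L ^ 2 / n * a * b * Real.exp θ * (α * β)
        ≤ L ^ 2 / n * a * b * (3 * (g + 1 / u + 1 / v)) * (α * β) := by
          gcongr; linarith
      _ = L * (3 * (u * v) + 3 * (u + v) * (1 / g)) := by
          have : L ^ 2 / n * a * b * (α * β) = L * u * v / g := by
            rw [hu, hv, hgdef]; field_simp
          calc _ = 3 * (L ^ 2 / n * a * b * (α * β)) * (g + 1 / u + 1 / v) := by ring
            _ = _ := by rw [this]; field_simp; ring
  have f2 : α * β * (b * Real.log (Real.exp 1 * n / b)) =
      L * v * (ρ * Real.log (Real.exp 1 * n / b)) := by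
    rw [hv, hρ]; field_simp
  have f3 : α * β * (a * Real.log (Real.exp 1 * n / a)) =
      L * u * (ρ' * Real.log (Real.exp 1 * n / a)) := by
    rw [hu, hρ']; field_simp
  have g2 : L * v * (ρ * Real.log (Real.exp 1 * n / b)) ≤ L * v * (5 * √ρ * θ) := by gcongr
  have g3 : L * u * (ρ' * Real.log (Real.exp 1 * n / a)) ≤ L * u * (5 * √ρ' * θ) := by gcongr
  have hR0 : 0 ≤ 3 * (u * v) + 3 * (u + v) * (1 / g) := by positivity
  -- The entropy terms already carry a factor `θ`, and the remaining term gains one for free because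
  -- `θ ≥ 1`; then `θ` cancels.
  have main : θ * (α * β * E) ≤ θ * (κ * L * (3 * (u * v) + 3 * (u + v) * (1 / g) +
      5 * v * √ρ + 5 * u * √ρ')) := by
    calc θ * (α * β * E) = α * β * (θ * E) := by ring
      _ ≤ α * β * (κ * (L ^ 2 / n * a * b * Real.exp θ +
          a * Real.log (Real.exp 1 * n / a) + b * Real.log (Real.exp 1 * n / b))) := by gcongr
      _ = κ * (L ^ 2 / n * a * b * Real.exp θ * (α * β) +
          α * β * (a * Real.log (Real.exp 1 * n / a)) +
          α * β * (b * Real.log (Real.exp 1 * n / b))) := by ring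
      _ ≤ κ * (L * (3 * (u * v) + 3 * (u + v) * (1 / g)) + L * u * (5 * √ρ' * θ) +
          L * v * (5 * √ρ * θ)) := by
          refine mul_le_mul_of_nonneg_left ?_ hκ
          rw [f2, f3]; linarith
      _ ≤ κ * (θ * (L * (3 * (u * v) + 3 * (u + v) * (1 / g))) + L * u * (5 * √ρ' * θ) +
          L * v * (5 * √ρ * θ)) := by
          refine mul_le_mul_of_nonneg_left ?_ hκ
          have := le_mul_of_one_le_left (mul_nonneg hL0.le hR0) hθR
          linarith
      _ = _ := by ring
  have := le_of_mul_le_mul_left main (by linarith)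
  refine this.trans (mul_le_mul_of_nonneg_left ?_ hκL)
  have : 0 ≤ 1 / ρ := by positivity
  linarith

theorem sum_mul_le_of_inner_le {R : ℕ} {u : ℕ → ℝ} {f : ℕ → ℕ → ℝ} {U B : ℝ} (hu : ∀ l, 0 ≤ u l)
    (hU : ∑ l ∈ Finset.range R, u l ≤ U) (hB : 0 ≤ B)
    (hf : ∀ l, ∑ k ∈ Finset.range R, f l k ≤ B) :
    ∑ l ∈ Finset.range R, ∑ k ∈ Finset.range R, u l * f l k ≤ U * B := by
  calc _ ≤ ∑ l ∈ Finset.range R, u l * B := by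
        refine Finset.sum_le_sum fun l _ => ?_
        rw [← Finset.mul_sum]
        exact mul_le_mul_of_nonneg_left (hf l) (hu l)
    _ = (∑ l ∈ Finset.range R, u l) * B := by rw [Finset.sum_mul]
    _ ≤ U * B := mul_le_mul_of_nonneg_right hU hB

/-- The conditions on `t` sit inside the existential so that `choose` gives a level for every index;
zero entries get an arbitrary one. -/
theorem exists_dyadic_level (t : ℝ) :
    ∃ l : ℕ, t ≠ 0 → |t| ≤ 1 → (1 / 2 : ℝ) ^ (l + 1) < |t| ∧ |t| ≤ (1 / 2 : ℝ) ^ l := by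
  by_cases h : t ≠ 0 ∧ |t| ≤ 1
  · obtain ⟨l, hl⟩ := exists_nat_pow_near_of_lt_one (abs_pos.2 h.1) h.2
      (by norm_num : (0 : ℝ) < 1 / 2) (by norm_num)
    exact ⟨l, fun _ _ => hl⟩
  · exact ⟨0, fun h1 h2 => absurd ⟨h1, h2⟩ h⟩

theorem abs_le_one_of_sum_sq_le_one {ι : Type*} [Fintype ι] {x : ι → ℝ} (hx : ∑ i, x i ^ 2 ≤ 1)
    (i : ι) : |x i| ≤ 1 := by
  rw [← sq_le_one_iff_abs_le_one]
  exact (Finset.single_le_sum (f := fun i => x i ^ 2) (fun i _ => sq_nonneg _)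
    (Finset.mem_univ i)).trans hx

/-- On level `l` each entry satisfies `4 x_i² ≥ (1/2)^(2l)`, so the levels together weigh at most `4
∑ x_i²`. -/
theorem sum_level_card_le {n : ℕ} {x : Fin n → ℝ} (hx : ∑ i, x i ^ 2 ≤ 1) {lx : Fin n → ℕ}
    (hlx : ∀ i, x i ≠ 0 → |x i| ≤ 1 → (1 / 2 : ℝ) ^ (lx i + 1) < |x i| ∧ |x i| ≤ (1 / 2 : ℝ) ^ lx i)
    {R : ℕ} (hR : ∀ i, lx i < R) :
    ∑ l ∈ Finset.range R, (((Finset.univ.filter fun i => x i ≠ 0).filter fun i => lx i = l).card : ℝ)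
      * ((1 / 2 : ℝ) ^ l) ^ 2 ≤ 4 := by
  calc _ ≤ ∑ l ∈ Finset.range R, ∑ i ∈ (Finset.univ.filter fun i => x i ≠ 0).filter
          (fun i => lx i = l), 4 * x i ^ 2 := by
        refine Finset.sum_le_sum fun l _ => ?_
        rw [← nsmul_eq_mul]
        refine Finset.card_nsmul_le_sum _ _ _ fun i hi => ?_
        simp only [Finset.mem_filter, Finset.mem_univ, true_and] at hi
        have h1 := (hlx i hi.1 (abs_le_one_of_sum_sq_le_one hx i)).1
        rw [hi.2, pow_succ] at h1
        have h2 : (0 : ℝ) < (1 / 2) ^ l := by positivity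
        rw [← sq_abs (x i)]
        nlinarith
    _ = ∑ i ∈ Finset.univ.filter (fun i => x i ≠ 0), 4 * x i ^ 2 :=
        Finset.sum_fiberwise_of_maps_to (fun i _ => Finset.mem_range.2 (hR i)) _
    _ ≤ ∑ i, 4 * x i ^ 2 := Finset.sum_le_sum_of_subset_of_nonneg (Finset.subset_univ _)
        fun i _ _ => by positivity
    _ ≤ 4 := by rw [← Finset.mul_sum]; linarith

/-- Under the degree bounds and the discrepancy property, the pairs whose coefficients are large
contribute little to a bilinear form (Kahn–Szemerédi). -/
theorem sum_heavy_le {n : ℕ} (hn : 0 < n) {A : Fin n → Fin n → ℝ} (hA : ∀ i j, 0 ≤ A i j)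
    {L κ : ℝ} (hL : 1 ≤ L) (hκ : 0 ≤ κ)
    (hrow : ∀ i, ∑ j, A i j ≤ κ * L ^ 2) (hcol : ∀ j, ∑ i, A i j ≤ κ * L ^ 2)
    (hdisc : ∀ S T : Finset (Fin n), S.Nonempty → T.Nonempty → ∀ θ : ℕ, 1 ≤ θ → θ ≤ 3 * n →
      θ * ∑ i ∈ S, ∑ j ∈ T, A i j ≤ κ * (L ^ 2 / n * S.card * T.card * Real.exp θ +
        S.card * Real.log (Real.exp 1 * n / S.card) + T.card * Real.log (Real.exp 1 * n / T.card)))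
    {x y : Fin n → ℝ} (hx : ∑ i, x i ^ 2 ≤ 1) (hy : ∑ i, y i ^ 2 ≤ 1) :
    ∑ i, ∑ j, (if Real.exp 1 * L / n < |x i| * |y j| then A i j * (|x i| * |y j|) else 0)
      ≤ 300 * κ * L := by
  have hn0 : (0 : ℝ) < n := by exact_mod_cast hn
  choose lx hlx using fun i => exists_dyadic_level (x i)
  choose ly hly using fun i => exists_dyadic_level (y i)
  obtain ⟨R, hRx, hRy⟩ : ∃ R, (∀ i, lx i < R) ∧ ∀ i, ly i < R := by
    refine ⟨(∑ i, lx i) + (∑ i, ly i) + 1, fun i => ?_, fun i => ?_⟩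
    · have := Finset.single_le_sum (f := lx) (fun i _ => Nat.zero_le _) (Finset.mem_univ i)
      omega
    · have := Finset.single_le_sum (f := ly) (fun i _ => Nat.zero_le _) (Finset.mem_univ i)
      omega
  have hU := sum_level_card_le hx hlx hRx
  have hV := sum_level_card_le hy hly hRy
  set S : ℕ → Finset (Fin n) := fun l => (Finset.univ.filter fun i => x i ≠ 0).filter
    fun i => lx i = l with hS
  set T : ℕ → Finset (Fin n) := fun l => (Finset.univ.filter fun i => y i ≠ 0).filter
    fun i => ly i = l with hT
  set α : ℕ → ℝ := fun l => (1 / 2 : ℝ) ^ l with hα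
  have hα0 : ∀ l, 0 < α l := fun l => by simp only [hα]; positivity
  have hα1 : ∀ l, α l ≤ 1 := fun l => pow_le_one₀ (by norm_num) (by norm_num)
  obtain ⟨u, hu⟩ : ∃ u : ℕ → ℝ, u = fun l => ((S l).card : ℝ) * α l ^ 2 := ⟨_, rfl⟩
  obtain ⟨v, hv⟩ : ∃ v : ℕ → ℝ, v = fun l => ((T l).card : ℝ) * α l ^ 2 := ⟨_, rfl⟩
  have hu0 : ∀ l, 0 ≤ u l := fun l => by rw [hu]; positivity
  have hv0 : ∀ l, 0 ≤ v l := fun l => by rw [hv]; positivity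
  replace hU : ∑ l ∈ Finset.range R, u l ≤ 4 := by rw [hu]; exact hU
  replace hV : ∑ l ∈ Finset.range R, v l ≤ 4 := by rw [hv]; exact hV
  obtain ⟨h, hh⟩ : ∃ h : Fin n → Fin n → ℝ, h = fun i j =>
    if Real.exp 1 * L / n < |x i| * |y j| then A i j * (|x i| * |y j|) else 0 := ⟨_, rfl⟩
  have hdecomp : ∑ i, ∑ j, h i j = ∑ l ∈ Finset.range R, ∑ k ∈ Finset.range R,
      ∑ i ∈ S l, ∑ j ∈ T k, h i j := by
    have e1 : ∀ i, ∑ j, h i j = ∑ k ∈ Finset.range R, ∑ j ∈ T k, h i j := by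
      intro i
      rw [Finset.sum_fiberwise_of_maps_to (fun i _ => Finset.mem_range.2 (hRy i))]
      symm
      refine Finset.sum_filter_of_ne fun j _ hj => ?_
      rintro h0
      apply hj
      simp [hh, h0]
    have e2 : ∑ i, ∑ j, h i j = ∑ l ∈ Finset.range R, ∑ i ∈ S l, ∑ j, h i j := by
      rw [Finset.sum_fiberwise_of_maps_to (fun i _ => Finset.mem_range.2 (hRx i))]
      symm
      refine Finset.sum_filter_of_ne fun i _ hi => ?_
      rintro h0
      apply hi
      simp [hh, h0]
    rw [e2]
    refine Finset.sum_congr rfl fun l _ => ?_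
    rw [Finset.sum_congr rfl fun i _ => e1 i, Finset.sum_comm]
  -- Except for `u l * v k`, each summand is a mass in one index times a clipped geometric term in
  -- the other, so its double sum is bounded independently of the number of levels.
  obtain ⟨G, hG⟩ : ∃ G : ℕ → ℕ → ℝ, G = fun l k => 3 * (u l * v k) +
      3 * (u l + v k) * clip (L / (n * α l * α k)) +
      5 * v k * clip (√(α l / (α k * L))) + 5 * u l * clip (√(α k / (α l * L))) +
      u l * clip (α k * L / α l) + v k * clip (α l * L / α k) := ⟨_, rfl⟩
  have hL0 : 0 < L := by linarith
  have hG0 : ∀ l k, 0 ≤ G l k := by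
    intro l k
    have h1 := hα0 l
    have h2 := hα0 k
    have h3 := hu0 l
    have h4 := hv0 k
    have c1 : 0 ≤ clip (L / (n * α l * α k)) := clip_nonneg (by positivity)
    have c2 : 0 ≤ clip (√(α l / (α k * L))) := clip_nonneg (by positivity)
    have c3 : 0 ≤ clip (√(α k / (α l * L))) := clip_nonneg (by positivity)
    have c4 : 0 ≤ clip (α k * L / α l) := clip_nonneg (by positivity)
    have c5 : 0 ≤ clip (α l * L / α k) := clip_nonneg (by positivity)
    rw [hG]
    positivity
  have hlevel : ∀ l k, ∑ i ∈ S l, ∑ j ∈ T k, h i j ≤ κ * L * G l k := by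
    intro l k
    have hGn : 0 ≤ κ * L * G l k := mul_nonneg (by positivity) (hG0 l k)
    have hmem : ∀ i ∈ S l, ∀ j ∈ T k, |x i| * |y j| ≤ α l * α k := by
      intro i hi j hj
      simp only [hS, hT, Finset.mem_filter, Finset.mem_univ, true_and] at hi hj
      have h1 := (hlx i hi.1 (abs_le_one_of_sum_sq_le_one hx i)).2
      have h2 := (hly j hj.1 (abs_le_one_of_sum_sq_le_one hy j)).2
      rw [hi.2] at h1
      rw [hj.2] at h2
      exact mul_le_mul h1 h2 (abs_nonneg _) (hα0 l).le
    by_cases hg : Real.exp 1 * L < n * α l * α k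
    · rcases (S l).eq_empty_or_nonempty with hSe | hSn
      · rw [hSe]; simpa using hGn
      rcases (T k).eq_empty_or_nonempty with hTe | hTn
      · rw [hTe]; simpa using hGn
      have hsub : ∑ i ∈ S l, ∑ j ∈ T k, h i j ≤ α l * α k * ∑ i ∈ S l, ∑ j ∈ T k, A i j := by
        rw [Finset.mul_sum]
        refine Finset.sum_le_sum fun i hi => ?_
        rw [Finset.mul_sum]
        refine Finset.sum_le_sum fun j hj => ?_
        rw [hh]
        dsimp only
        have hpos := mul_pos (hα0 l) (hα0 k)
        split_ifs
        · rw [mul_comm]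
          exact mul_le_mul_of_nonneg_right (hmem i hi j hj) (hA i j)
        · exact mul_nonneg hpos.le (hA i j)
      refine hsub.trans ?_
      have hSc : (1 : ℝ) ≤ (S l).card := by exact_mod_cast hSn.card_pos
      have hTc : (1 : ℝ) ≤ (T k).card := by exact_mod_cast hTn.card_pos
      have key := level_pair_le (E := ∑ i ∈ S l, ∑ j ∈ T k, A i j) hL hκ hSc hTc (hα0 l) (hα1 l)
        (hα0 k) (hα1 k) hn hg ?_ ?_ (hdisc _ _ hSn hTn)
      · rw [hG, hu, hv]; exact key
      · calc ∑ i ∈ S l, ∑ j ∈ T k, A i j ≤ ∑ i ∈ S l, κ * L ^ 2 := by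
              refine Finset.sum_le_sum fun i _ => (Finset.sum_le_sum_of_subset_of_nonneg
                (Finset.subset_univ _) fun j _ _ => hA i j).trans (hrow i)
          _ = _ := by rw [Finset.sum_const, nsmul_eq_mul]; ring
      · rw [Finset.sum_comm]
        calc ∑ j ∈ T k, ∑ i ∈ S l, A i j ≤ ∑ j ∈ T k, κ * L ^ 2 := by
              refine Finset.sum_le_sum fun j _ => (Finset.sum_le_sum_of_subset_of_nonneg
                (Finset.subset_univ _) fun i _ _ => hA i j).trans (hcol j)
          _ = _ := by rw [Finset.sum_const, nsmul_eq_mul]; ring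
    -- Here no product of entries from the two levels reaches the threshold, so every summand is
    -- zero.
    · refine le_trans (Finset.sum_nonpos fun i hi => Finset.sum_nonpos fun j hj => ?_) hGn
      rw [hh]
      dsimp only
      rw [if_neg]
      rw [not_lt, le_div_iff₀ hn0]
      have := mul_le_mul_of_nonneg_right (hmem i hi j hj) hn0.le
      linarith
  -- The sum is at most `3·16 + 3·8 + 3·8 + 5·16 + 5·16 + 8 + 8 = 272`.
  have hsumG : ∑ l ∈ Finset.range R, ∑ k ∈ Finset.range R, G l k ≤ 300 := by
    have s0 : ∑ l ∈ Finset.range R, ∑ k ∈ Finset.range R, u l * v k ≤ 4 * 4 :=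
      sum_mul_le_of_inner_le hu0 hU (by norm_num) fun l => hV
    have s1 : ∑ l ∈ Finset.range R, ∑ k ∈ Finset.range R, u l * clip (L / (n * α l * α k))
        ≤ 4 * 2 := by
      refine sum_mul_le_of_inner_le hu0 hU (by norm_num) fun l => ?_
      have := hα0 l
      simp only [← div_div]
      exact sum_clip_div_half_pow_le (by positivity) R
    have s2 : ∑ l ∈ Finset.range R, ∑ k ∈ Finset.range R, v k * clip (L / (n * α l * α k))
        ≤ 4 * 2 := by
      rw [Finset.sum_comm]
      refine sum_mul_le_of_inner_le hv0 hV (by norm_num) fun k => ?_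
      have := hα0 k
      simp only [mul_right_comm _ _ (α k), ← div_div]
      exact sum_clip_div_half_pow_le (by positivity) R
    have s3 : ∑ l ∈ Finset.range R, ∑ k ∈ Finset.range R, v k * clip (√(α l / (α k * L)))
        ≤ 4 * 4 := by
      rw [Finset.sum_comm]
      refine sum_mul_le_of_inner_le hv0 hV (by norm_num) fun k => ?_
      have := hα0 k
      simp only [div_eq_inv_mul (α _) (α k * L)]
      exact sum_clip_sqrt_mul_half_pow_le (by positivity) R
    have s4 : ∑ l ∈ Finset.range R, ∑ k ∈ Finset.range R, u l * clip (√(α k / (α l * L)))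
        ≤ 4 * 4 := by
      refine sum_mul_le_of_inner_le hu0 hU (by norm_num) fun l => ?_
      have := hα0 l
      simp only [div_eq_inv_mul _ (α l * L)]
      exact sum_clip_sqrt_mul_half_pow_le (by positivity) R
    have s5 : ∑ l ∈ Finset.range R, ∑ k ∈ Finset.range R, u l * clip (α k * L / α l) ≤ 4 * 2 := by
      refine sum_mul_le_of_inner_le hu0 hU (by norm_num) fun l => ?_
      have := hα0 l
      have e : ∀ k, α k * L / α l = L / α l * α k := fun k => by ring
      simp only [e]
      exact sum_clip_div_two_pow_le (by positivity) R
    have s6 : ∑ l ∈ Finset.range R, ∑ k ∈ Finset.range R, v k * clip (α l * L / α k) ≤ 4 * 2 := by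
      rw [Finset.sum_comm]
      refine sum_mul_le_of_inner_le hv0 hV (by norm_num) fun k => ?_
      have := hα0 k
      have e : ∀ l, α l * L / α k = L / α k * α l := fun l => by ring
      simp only [e]
      exact sum_clip_div_two_pow_le (by positivity) R
    have hGe : ∀ l k, G l k = 3 * (u l * v k) + 3 * (u l * clip (L / (n * α l * α k))) +
        3 * (v k * clip (L / (n * α l * α k))) + 5 * (v k * clip (√(α l / (α k * L)))) +
        5 * (u l * clip (√(α k / (α l * L)))) + u l * clip (α k * L / α l) +
        v k * clip (α l * L / α k) := by
      intro l k; rw [hG]; ring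
    simp only [hGe, Finset.sum_add_distrib, ← Finset.mul_sum] at s0 s1 s4 s5 ⊢
    linarith
  calc _ = ∑ i, ∑ j, h i j := by rw [hh]
    _ ≤ ∑ l ∈ Finset.range R, ∑ k ∈ Finset.range R, κ * L * G l k := by
        rw [hdecomp]
        exact Finset.sum_le_sum fun l _ => Finset.sum_le_sum fun k _ => hlevel l k
    _ = κ * L * ∑ l ∈ Finset.range R, ∑ k ∈ Finset.range R, G l k := by
        simp only [Finset.mul_sum]
    _ ≤ κ * L * 300 := mul_le_mul_of_nonneg_left hsumG (by positivity)
    _ = 300 * κ * L := by ring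

/-! ### Norming sets for quadratic forms -/

-- A maximal 1-separated subset of the ball of radius 2 is a 1-net of it and has at most `5^n`
-- points by volume comparison. Halved, it is a 1/2-net of the unit ball, which norms every vector
-- up to a factor 2.
open Module in
theorem exists_finset_norming (n : ℕ) : ∃ F : Finset (Fin n → ℝ), F.card ≤ 5 ^ n ∧
    (∀ x ∈ F, ∑ i, x i ^ 2 ≤ 1) ∧
    ∀ v : Fin n → ℝ, ∃ x ∈ F, √(∑ i, v i ^ 2) ≤ 2 * ∑ i, v i * x i := by
  classical
  let E := EuclideanSpace ℝ (Fin n)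
  let P : Finset E → Prop := fun s => (∀ c ∈ s, ‖c‖ ≤ 2) ∧
    ∀ c ∈ s, ∀ c' ∈ s, c ≠ c' → 1 ≤ ‖c - c'‖
  have hcard : ∀ s, P s → s.card ≤ 5 ^ n := by
    intro s hs
    have := Besicovitch.card_le_of_separated s hs.1 hs.2
    rwa [finrank_euclideanSpace_fin] at this
  have hbdd : BddAbove {m | ∃ s, P s ∧ s.card = m} := by
    refine ⟨5 ^ n, ?_⟩
    rintro m ⟨s, hs, rfl⟩
    exact hcard s hs
  have hne : {m | ∃ s, P s ∧ s.card = m}.Nonempty :=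
    ⟨0, ∅, ⟨by simp, by simp⟩, by simp⟩
  obtain ⟨s, hs, hsm⟩ := Nat.sSup_mem hne hbdd
  have hmax : ∀ t, P t → t.card ≤ s.card := by
    intro t ht
    rw [hsm]
    exact le_csSup hbdd ⟨t, ht, rfl⟩
  have hnet : ∀ w : E, ‖w‖ ≤ 2 → ∃ c ∈ s, ‖w - c‖ ≤ 1 := by
    intro w hw
    by_contra! hcon
    have hws : w ∉ s := fun h => by have := hcon w h; simp at this; linarith
    have hP : P (insert w s) := by
      refine ⟨?_, ?_⟩
      · intro c hc
        rcases Finset.mem_insert.1 hc with rfl | hc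
        · exact hw
        · exact hs.1 c hc
      · intro c hc c' hc' hcc
        rcases Finset.mem_insert.1 hc with h1 | h1 <;>
          rcases Finset.mem_insert.1 hc' with h2 | h2
        · exact absurd (h1.trans h2.symm) hcc
        · rw [h1]; exact (hcon c' h2).le
        · rw [norm_sub_rev, h2]; exact (hcon c h1).le
        · exact hs.2 c h1 c' h2 hcc
    have := hmax _ hP
    rw [Finset.card_insert_of_notMem hws] at this
    omega
  refine ⟨s.image fun c i => (1 / 2) * c i, Finset.card_image_le.trans (hcard s hs), ?_, ?_⟩
  · intro x hx
    obtain ⟨c, hc, rfl⟩ := Finset.mem_image.1 hx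
    have h1 := hs.1 c hc
    have h2 := EuclideanSpace.real_norm_sq_eq c
    have h3 : ‖c‖ ^ 2 ≤ 4 := by nlinarith [norm_nonneg c]
    simp only [mul_pow, ← Finset.mul_sum]
    rw [← h2]
    linarith
  · intro v
    set v' : E := WithLp.toLp 2 v with hv'
    have hvn : √(∑ i, v i ^ 2) = ‖v'‖ := by
      rw [EuclideanSpace.norm_eq]; simp [hv']
    have hin : ∀ c : E, 2 * ∑ i, v i * ((1 / 2) * c i) = inner ℝ v' c := by
      intro c
      rw [Finset.mul_sum, PiLp.inner_apply]
      refine Finset.sum_congr rfl fun i _ => ?_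
      simp [hv']
      ring
    by_cases h0 : v' = 0
    · obtain ⟨c, hc, -⟩ := hnet 0 (by simp)
      refine ⟨_, Finset.mem_image_of_mem _ hc, ?_⟩
      rw [hvn, hin, h0]; simp
    · have hpos : 0 < ‖v'‖ := norm_pos_iff.2 h0
      -- With `c` within 1 of `2v/‖v‖`, the inner product satisfies `⟨v, c⟩ ≥ 2‖v‖ - ‖v‖`.
      obtain ⟨c, hc, hcw⟩ := hnet ((2 / ‖v'‖) • v') (by
        rw [norm_smul, Real.norm_of_nonneg (by positivity)]
        exact (div_mul_cancel₀ _ hpos.ne').le)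
      refine ⟨_, Finset.mem_image_of_mem _ hc, ?_⟩
      rw [hvn, hin]
      have h1 : inner ℝ v' ((2 / ‖v'‖) • v' - c) ≤ ‖v'‖ :=
        (real_inner_le_norm _ _).trans (mul_le_of_le_one_right hpos.le hcw)
      rw [inner_sub_right, inner_smul_right, real_inner_self_eq_norm_sq] at h1
      have h2 : 2 / ‖v'‖ * ‖v'‖ ^ 2 = 2 * ‖v'‖ := by field_simp
      linarith

/-- A quadratic form is bounded through the values of the bilinear form on a norming set. -/
theorem quadratic_le_of_norming {n : ℕ} {F : Finset (Fin n → ℝ)}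
    (hF : ∀ v : Fin n → ℝ, ∃ x ∈ F, √(∑ i, v i ^ 2) ≤ 2 * ∑ i, v i * x i)
    {N : Fin n → Fin n → ℝ} {B : ℝ}
    (hB : ∀ x ∈ F, ∀ y ∈ F, ∑ i, ∑ j, x i * y j * N i j ≤ B) (x : Fin n → ℝ) :
    ∑ i, ∑ j, x i * x j * N i j ≤ 4 * B * ∑ i, x i ^ 2 := by
  have h1 : ∀ y ∈ F, √(∑ i, (∑ j, N i j * y j) ^ 2) ≤ 2 * B := by
    intro y hy
    obtain ⟨z, hz, hzv⟩ := hF fun i => ∑ j, N i j * y j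
    refine hzv.trans ?_
    have := hB z hz y hy
    have e : ∑ i, (∑ j, N i j * y j) * z i = ∑ i, ∑ j, z i * y j * N i j := by
      refine Finset.sum_congr rfl fun i _ => ?_
      rw [Finset.sum_mul]
      exact Finset.sum_congr rfl fun j _ => by ring
    rw [e]; linarith
  obtain ⟨y, hy, hyx⟩ := hF fun j => ∑ i, N i j * x i
  have h2 : ∑ j, (∑ i, N i j * x i) * y j = ∑ i, x i * ∑ j, N i j * y j := by
    simp only [Finset.sum_mul, Finset.mul_sum]
    rw [Finset.sum_comm]
    exact Finset.sum_congr rfl fun i _ => Finset.sum_congr rfl fun j _ => by ring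
  have h3 := Real.sum_mul_le_sqrt_mul_sqrt Finset.univ x fun i => ∑ j, N i j * y j
  have h4 : √(∑ j, (∑ i, N i j * x i) ^ 2) ≤ 4 * B * √(∑ i, x i ^ 2) := by
    refine hyx.trans ?_
    rw [h2]
    nlinarith [mul_le_mul_of_nonneg_left (h1 y hy) (Real.sqrt_nonneg (∑ i, x i ^ 2))]
  have h5 : ∑ i, ∑ j, x i * x j * N i j = ∑ j, x j * ∑ i, N i j * x i := by
    rw [Finset.sum_comm]
    simp only [Finset.mul_sum]
    exact Finset.sum_congr rfl fun i _ => Finset.sum_congr rfl fun j _ => by ring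
  rw [h5]
  refine (Real.sum_mul_le_sqrt_mul_sqrt Finset.univ x fun j => ∑ i, N i j * x i).trans ?_
  have h6 : √(∑ i, x i ^ 2) * √(∑ i, x i ^ 2) = ∑ i, x i ^ 2 :=
    Real.mul_self_sqrt (Finset.sum_nonneg fun i _ => sq_nonneg _)
  calc _ ≤ √(∑ i, x i ^ 2) * (4 * B * √(∑ i, x i ^ 2)) :=
        mul_le_mul_of_nonneg_left h4 (Real.sqrt_nonneg _)
    _ = 4 * B * (√(∑ i, x i ^ 2) * √(∑ i, x i ^ 2)) := by ring
    _ = _ := by rw [h6]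

theorem IsWHSBM.integral_nonneg {Ω : Type*} [MeasurableSpace Ω] {μ : Measure Ω}
    {n k d : ℕ} {p q : ℝ} {Φ : Fin n → Fin k} {W : Edge n d → Ω → ℝ} (h : IsWHSBM μ p q Φ W) (e : Edge n d) : 0 ≤ ∫ ω, W e ω ∂μ :=
  integral_nonneg_of_ae ((h.weight_mem e).mono fun _ h => h.1)

theorem IsWHSBM.integral_le {Ω : Type*} [MeasurableSpace Ω] {μ : Measure Ω}
    {n k d : ℕ} {p q : ℝ} {Φ : Fin n → Fin k} {W : Edge n d → Ω → ℝ} (h : IsWHSBM μ p q Φ W) (hqp : q ≤ p) (e : Edge n d) :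
    ∫ ω, W e ω ∂μ ≤ p := by
  by_cases he : IsHomogeneous Φ e
  · exact (h.mean_homogeneous e he).le
  · exact (h.mean_heterogeneous e he).trans_le hqp

/-! ### Tail bounds for linear functionals of the similarity matrix -/

section Tails

variable {Ω : Type*} [MeasurableSpace Ω] {μ : Measure Ω} [IsProbabilityMeasure μ]
  {n k d : ℕ} {p q : ℝ} {Φ : Fin n → Fin k} {W : Edge n d → Ω → ℝ}

/-- Deviation of a linear functional of the similarity matrix from its mean. -/
theorem IsWHSBM.measure_deviation_ge_le (h : IsWHSBM μ p q Φ W) (hqp : q ≤ p) (hd : 2 ≤ d)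
    {c : Fin n → Fin n → ℝ} {τ V : ℝ} (hτ : 0 < τ) (hc : ∀ i j, |c i j| ≤ τ)
    (hV : ∑ i, ∑ j, c i j ^ 2 ≤ V) (t : ℝ) :
    μ.real {ω | t ≤ ∑ i, ∑ j, c i j *
        similarityMatrix (fun e => W e ω - ∫ ω', W e ω' ∂μ) i j} ≤
      Real.exp (((n - 2).choose (d - 2) : ℝ) * p * V / ((d : ℝ) ^ 2 * τ ^ 2)
        - t / ((d : ℝ) ^ 2 * τ)) := by
  have hd0 : (0 : ℝ) < d := by exact_mod_cast (by omega : 0 < d)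
  have hD : 0 < (d : ℝ) ^ 2 * τ := by positivity
  have hp := h.p_mem.1
  -- Dividing by `d²τ` brings the edge coefficients into `[-1,1]`. The bound `τ` need not be sharp:
  -- choosing it large tunes the exponent.
  have key := measure_centered_sum_ge_le h.measurable h.indep h.weight_mem (h.integral_le hqp)
    (c := fun e => edgeSum c e / ((d : ℝ) ^ 2 * τ))
    (fun e => by rw [abs_div, abs_of_pos hD, div_le_one hD]; exact abs_edgeSum_le hτ.le hc e)
    (t / ((d : ℝ) ^ 2 * τ))
  have hset : {ω | t ≤ ∑ i, ∑ j, c i j *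
        similarityMatrix (fun e => W e ω - ∫ ω', W e ω' ∂μ) i j} =
      {ω | t / ((d : ℝ) ^ 2 * τ) ≤ ∑ e, edgeSum c e / ((d : ℝ) ^ 2 * τ) *
        (W e ω - ∫ ω', W e ω' ∂μ)} := by
    ext ω
    simp only [Set.mem_ofPred_eq, div_mul_eq_mul_div]
    rw [sum_mul_similarityMatrix, ← Finset.sum_div, div_le_div_iff_of_pos_right hD]
  rw [hset]
  refine key.trans (Real.exp_le_exp.2 (sub_le_sub_right ?_ _))
  have h1 : ∑ e : Edge n d, edgeSum c e ^ 2 ≤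
      (d : ℝ) ^ 2 * (((n - 2).choose (d - 2) : ℝ) * V) := by
    calc _ ≤ ∑ e : Edge n d, (d : ℝ) ^ 2 * edgeSum (fun i j => c i j ^ 2) e :=
          Finset.sum_le_sum fun e _ => edgeSum_sq_le c e
      _ = (d : ℝ) ^ 2 * ∑ e : Edge n d, edgeSum (fun i j => c i j ^ 2) e := by
          rw [Finset.mul_sum]
      _ ≤ (d : ℝ) ^ 2 * (((n - 2).choose (d - 2) : ℝ) * ∑ i, ∑ j, c i j ^ 2) :=
          mul_le_mul_of_nonneg_left (sum_edgeSum_le hd fun i j => sq_nonneg _) (by positivity)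
      _ ≤ _ := by gcongr
  simp only [div_pow, ← Finset.sum_div]
  calc p * ((∑ e : Edge n d, edgeSum c e ^ 2) / ((d : ℝ) ^ 2 * τ) ^ 2)
      ≤ p * ((d : ℝ) ^ 2 * (((n - 2).choose (d - 2) : ℝ) * V) / ((d : ℝ) ^ 2 * τ) ^ 2) := by
        gcongr
    _ = _ := by field_simp

/-- Upper tail of the total similarity between two sets of nodes. -/
theorem IsWHSBM.measure_rect_ge_le (h : IsWHSBM μ p q Φ W) (hqp : q ≤ p) (hd : 2 ≤ d)
    (S T : Finset (Fin n)) {θ : ℝ} (hθ : 0 ≤ θ) (t : ℝ) :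
    μ.real {ω | (d : ℝ) ^ 2 * t ≤ θ * ∑ i ∈ S, ∑ j ∈ T, similarityMatrix (fun e => W e ω) i j} ≤
      Real.exp (((n - 2).choose (d - 2) : ℝ) * p * S.card * T.card * Real.exp θ - t) := by
  have hd1 : (1 : ℝ) ≤ d := by exact_mod_cast (by omega : 1 ≤ d)
  have hD1 : (1 : ℝ) ≤ (d : ℝ) ^ 2 := one_le_pow₀ hd1
  have hD : 0 < (d : ℝ) ^ 2 := by linarith
  have hp := h.p_mem.1
  obtain ⟨c, hc⟩ : ∃ c : Fin n → Fin n → ℝ, c = fun i j => if i ∈ S ∧ j ∈ T then 1 else 0 :=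
    ⟨_, rfl⟩
  have hc0 : ∀ i j, 0 ≤ c i j := fun i j => by rw [hc]; dsimp only; split_ifs <;> norm_num
  have hc1 : ∀ i j, |c i j| ≤ 1 := fun i j => by rw [hc]; dsimp only; split_ifs <;> norm_num
  have hrect : ∀ f : Fin n → Fin n → ℝ, ∑ i, ∑ j, c i j * f i j = ∑ i ∈ S, ∑ j ∈ T, f i j := by
    intro f
    rw [hc]
    rw [← Finset.sum_subset (Finset.subset_univ S)]
    · refine Finset.sum_congr rfl fun i hi => ?_
      rw [← Finset.sum_subset (Finset.subset_univ T)]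
      · exact Finset.sum_congr rfl fun j hj => by simp [hi, hj]
      · intro j _ hj
        simp [hj]
    · intro i _ hi
      simp [hi]
  have hcsum : ∑ i, ∑ j, c i j = S.card * T.card := by
    have := hrect fun _ _ => 1
    simpa using this
  have key := measure_weighted_sum_ge_le h.measurable h.indep h.weight_mem (h.integral_le hqp)
    (u := fun e => edgeSum c e / (d : ℝ) ^ 2)
    (fun e => ⟨div_nonneg (edgeSum_nonneg hc0 e) hD.le, by
      rw [div_le_one hD]
      simpa using (le_abs_self _).trans (abs_edgeSum_le zero_le_one hc1 e)⟩) hθ t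
  have hset : {ω | (d : ℝ) ^ 2 * t ≤
        θ * ∑ i ∈ S, ∑ j ∈ T, similarityMatrix (fun e => W e ω) i j} =
      {ω | t ≤ θ * ∑ e, edgeSum c e / (d : ℝ) ^ 2 * W e ω} := by
    ext ω
    simp only [Set.mem_ofPred_eq, div_mul_eq_mul_div]
    rw [← hrect fun i j => similarityMatrix (fun e => W e ω) i j, sum_mul_similarityMatrix, ← Finset.sum_div, ← mul_div_assoc, le_div_iff₀ hD,
      mul_comm t]
  rw [hset]
  refine key.trans (Real.exp_le_exp.2 (sub_le_sub_right ?_ _))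
  have h1 := sum_edgeSum_le (d := d) hd hc0
  rw [hcsum] at h1
  rw [← Finset.sum_div]
  have h2 : (∑ e : Edge n d, edgeSum c e) / (d : ℝ) ^ 2 ≤
      ((n - 2).choose (d - 2) : ℝ) * (S.card * T.card) :=
    (div_le_self (Finset.sum_nonneg fun e _ => edgeSum_nonneg hc0 e) hD1).trans h1
  have h3 : 0 ≤ Real.exp θ - 1 := by linarith [Real.add_one_le_exp θ]
  calc p * (Real.exp θ - 1) * ((∑ e : Edge n d, edgeSum c e) / (d : ℝ) ^ 2)
      ≤ p * (Real.exp θ - 1) * (((n - 2).choose (d - 2) : ℝ) * (S.card * T.card)) := by gcongr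
    _ ≤ p * Real.exp θ * (((n - 2).choose (d - 2) : ℝ) * (S.card * T.card)) := by
        gcongr; linarith
    _ = _ := by ring

end Tails

/-! ### Splitting the bilinear form into light and heavy pairs -/

/-- The part of the rank-one matrix `x yᵀ` with entries of size at most `τ`. -/
noncomputable def lightPart {n : ℕ} (τ : ℝ) (x y : Fin n → ℝ) (i j : Fin n) : ℝ :=
  if |x i| * |y j| ≤ τ then x i * y j else 0

theorem abs_lightPart_le {n : ℕ} {τ : ℝ} (hτ : 0 ≤ τ) (x y : Fin n → ℝ) (i j : Fin n) :
    |lightPart τ x y i j| ≤ τ := by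
  unfold lightPart
  split_ifs with h
  · rwa [abs_mul]
  · simpa using hτ

theorem sum_sq_mul_sq_le_one {n : ℕ} {x y : Fin n → ℝ} (hx : ∑ i, x i ^ 2 ≤ 1)
    (hy : ∑ i, y i ^ 2 ≤ 1) : ∑ i, ∑ j, x i ^ 2 * y j ^ 2 ≤ 1 := by
  simp only [← Finset.mul_sum, ← Finset.sum_mul]
  exact mul_le_one₀ hx (Finset.sum_nonneg fun i _ => sq_nonneg _) hy

theorem sum_lightPart_sq_le {n : ℕ} (τ : ℝ) {x y : Fin n → ℝ} (hx : ∑ i, x i ^ 2 ≤ 1)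
    (hy : ∑ i, y i ^ 2 ≤ 1) : ∑ i, ∑ j, lightPart τ x y i j ^ 2 ≤ 1 := by
  refine le_trans (Finset.sum_le_sum fun i _ => Finset.sum_le_sum fun j _ => ?_)
    (sum_sq_mul_sq_le_one hx hy)
  unfold lightPart
  split_ifs
  · rw [mul_pow]
  · simp; positivity

/-- The bilinear form of the centered similarity matrix is controlled by its light part, the
degree bounds and the discrepancy property. -/
theorem bilinear_le_of_light {n d : ℕ} (hn : 0 < n) (hd : 2 ≤ d) {w M : Edge n d → ℝ} {p L κ K : ℝ}
    (hp : 0 ≤ p) (hw : ∀ e, 0 ≤ w e) (hM0 : ∀ e, 0 ≤ M e) (hMp : ∀ e, M e ≤ p) (hL : 1 ≤ L)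
    (hL2 : L ^ 2 = n * (((n - 2).choose (d - 2) : ℝ) * p)) (hκ : 0 ≤ κ)
    (hrow : ∀ i, ∑ j, similarityMatrix w i j ≤ κ * L ^ 2)
    (hdisc : ∀ S T : Finset (Fin n), S.Nonempty → T.Nonempty → ∀ θ : ℕ, 1 ≤ θ → θ ≤ 3 * n →
      θ * ∑ i ∈ S, ∑ j ∈ T, similarityMatrix w i j ≤
        κ * (L ^ 2 / n * S.card * T.card * Real.exp θ +
        S.card * Real.log (Real.exp 1 * n / S.card) + T.card * Real.log (Real.exp 1 * n / T.card)))
    {x y : Fin n → ℝ} (hx : ∑ i, x i ^ 2 ≤ 1) (hy : ∑ i, y i ^ 2 ≤ 1)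
    (hlight : ∑ i, ∑ j, lightPart (Real.exp 1 * L / n) x y i j *
      similarityMatrix (fun e => w e - M e) i j ≤ K * L) :
    ∑ i, ∑ j, x i * y j * similarityMatrix (fun e => w e - M e) i j ≤
      (K + 1 + 300 * κ) * L := by
  have hn0 : (0 : ℝ) < n := by exact_mod_cast hn
  have hL0 : 0 < L := by linarith
  obtain ⟨m, hm⟩ : ∃ m, m = ((n - 2).choose (d - 2) : ℝ) * p := ⟨_, rfl⟩
  have hm0 : 0 ≤ m := by rw [hm]; positivity
  rw [← hm] at hL2
  obtain ⟨τ, hτ⟩ : ∃ τ, τ = Real.exp 1 * L / n := ⟨_, rfl⟩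
  have hτ0 : 0 < τ := by rw [hτ]; positivity
  have hheavy := sum_heavy_le hn (fun i j => similarityMatrix_nonneg hw i j) hL hκ hrow
    (fun j => by simpa only [similarityMatrix_symm w _ j] using hrow j) hdisc hx hy
  rw [← hτ] at hlight hheavy
  have hmean : ∀ i j, 0 ≤ similarityMatrix M i j ∧ similarityMatrix M i j ≤ m := by
    intro i j
    refine ⟨similarityMatrix_nonneg hM0 i j, (similarityMatrix_mono hMp i j).trans ?_⟩
    rw [similarityMatrix_const hd]
    split_ifs
    · exact hm0
    · exact hm.ge
  -- On a heavy pair with product `z > τ` the mean contributes at most `m z ≤ (m/τ) z²`, and the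
  -- `z²` sum to at most 1. Here `m/τ = L/e`.
  have hmτ : m / τ ≤ L := by
    rw [hτ, div_le_iff₀ (by positivity)]
    have h1 : L * (Real.exp 1 * L / n) = Real.exp 1 * (L ^ 2 / n) := by ring
    have h2 : L ^ 2 / n = m := by rw [hL2]; field_simp
    rw [h1, h2]
    exact le_mul_of_one_le_left hm0 (by linarith [Real.add_one_le_exp 1])
  have hpt : ∀ i j, x i * y j * similarityMatrix (fun e => w e - M e) i j ≤
      lightPart τ x y i j * similarityMatrix (fun e => w e - M e) i j +
      (if τ < |x i| * |y j| then similarityMatrix w i j * (|x i| * |y j|) else 0) +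
      m / τ * (x i ^ 2 * y j ^ 2) := by
    intro i j
    have hsq : 0 ≤ m / τ * (x i ^ 2 * y j ^ 2) := by positivity
    unfold lightPart
    by_cases h : |x i| * |y j| ≤ τ
    · rw [if_pos h, if_neg (not_lt.2 h)]; linarith
    · rw [if_neg h, if_pos (not_le.1 h)]
      have hN : similarityMatrix (fun e => w e - M e) i j =
          similarityMatrix w i j - similarityMatrix M i j := by
        rw [← similarityMatrix_sub]; rfl
      rw [hN, zero_mul, zero_add]
      have hlt := not_le.1 h
      obtain ⟨z, hz⟩ : ∃ z, z = |x i| * |y j| := ⟨_, rfl⟩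
      have hz2 : x i ^ 2 * y j ^ 2 = z ^ 2 := by rw [hz, mul_pow, sq_abs, sq_abs]
      rw [← hz] at hlt
      have habs : |x i * y j| = z := by rw [hz, abs_mul]
      obtain ⟨h1, h2⟩ := abs_le.1 habs.le
      rw [← hz, hz2]
      have hA := similarityMatrix_nonneg hw i j
      obtain ⟨hM1, hM2⟩ := hmean i j
      have h3 : m * z ≤ m / τ * z ^ 2 := by
        rw [div_mul_eq_mul_div, le_div_iff₀ hτ0]
        have : z * τ ≤ z * z := mul_le_mul_of_nonneg_left hlt.le (by linarith)
        nlinarith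
      have h4 : x i * y j * similarityMatrix w i j ≤ similarityMatrix w i j * z := by
        rw [mul_comm]; exact mul_le_mul_of_nonneg_left h2 hA
      have h5 : -(x i * y j * similarityMatrix M i j) ≤ m * z := by
        calc _ = -(x i * y j) * similarityMatrix M i j := by ring
          _ ≤ z * similarityMatrix M i j := mul_le_mul_of_nonneg_right (by linarith) hM1
          _ ≤ z * m := mul_le_mul_of_nonneg_left hM2 (by linarith)
          _ = _ := mul_comm _ _
      linarith
  calc _ ≤ ∑ i, ∑ j, (lightPart τ x y i j * similarityMatrix (fun e => w e - M e) i j +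
      (if τ < |x i| * |y j| then similarityMatrix w i j * (|x i| * |y j|) else 0) +
      m / τ * (x i ^ 2 * y j ^ 2)) :=
        Finset.sum_le_sum fun i _ => Finset.sum_le_sum fun j _ => hpt i j
    _ ≤ K * L + 300 * κ * L + m / τ * 1 := by
        simp only [Finset.sum_add_distrib]
        refine add_le_add (add_le_add hlight hheavy) ?_
        simp only [← Finset.mul_sum (a := m / τ)]
        exact mul_le_mul_of_nonneg_left (sum_sq_mul_sq_le_one hx hy) (by positivity)
    _ ≤ _ := by linarith

/-! ### Entropy of the choice of a set of nodes -/

/-- The difference of the two sides is `(a-1)(log n - log a) + (a - log a)`, and both summands are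
nonnegative. -/
theorem log_le_card_mul_log {n a : ℕ} (ha : 1 ≤ a) (han : a ≤ n) :
    Real.log n ≤ a * Real.log (Real.exp 1 * n / a) := by
  have ha1 : (1 : ℝ) ≤ a := by exact_mod_cast ha
  have han' : (a : ℝ) ≤ n := by exact_mod_cast han
  have ha0 : (0 : ℝ) < a := by linarith
  have hn0 : (0 : ℝ) < n := by linarith
  rw [Real.log_div (by positivity) ha0.ne', Real.log_mul (by positivity) hn0.ne', Real.log_exp]
  have h1 := Real.log_le_sub_one_of_pos ha0
  have h2 := Real.log_le_log ha0 han'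
  nlinarith

/-- The right side is `(en/a)^a`; use `C(n,a) ≤ n^a/a!` and `a^a/a! ≤ e^a`. -/
theorem choose_le_exp {n a : ℕ} (ha : 1 ≤ a) (han : a ≤ n) :
    (n.choose a : ℝ) ≤ Real.exp (a * Real.log (Real.exp 1 * n / a)) := by
  have ha0 : (0 : ℝ) < a := by exact_mod_cast ha
  have hn0 : (0 : ℝ) < n := by exact_mod_cast (by omega : 0 < n)
  have h1 : (n.choose a : ℝ) ≤ (n : ℝ) ^ a / a.factorial := Nat.choose_le_pow_div a n
  have h2 := Real.pow_div_factorial_le_exp (a : ℝ) ha0.le a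
  have h3 : Real.exp (a * Real.log (Real.exp 1 * n / a)) = (n : ℝ) ^ a * Real.exp a / a ^ a := by
    rw [mul_comm (a : ℝ), ← Real.rpow_def_of_pos (by positivity), Real.rpow_natCast, div_pow,
      mul_pow, ← Real.exp_nat_mul, mul_one]
    ring
  rw [h3]
  refine h1.trans ?_
  have hf : (0 : ℝ) < a.factorial := by exact_mod_cast a.factorial_pos
  rw [div_le_iff₀ hf] at h2
  rw [div_le_div_iff₀ hf (by positivity)]
  calc (n : ℝ) ^ a * (a : ℝ) ^ a ≤ (n : ℝ) ^ a * (Real.exp a * a.factorial) := by gcongr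
    _ = _ := by ring

/-- Group the sets by size. One of the 14 copies of the entropy pays for the number of sets of that
size, the other 13 give `n⁻¹³`, and there are `n` sizes. -/
theorem sum_exp_neg_card_mul_log_le {n : ℕ} (hn : 0 < n) :
    ∑ S ∈ (Finset.univ : Finset (Fin n)).powerset.filter Finset.Nonempty,
      Real.exp (-(14 * (S.card * Real.log (Real.exp 1 * n / S.card)))) ≤ ((n : ℝ)⁻¹) ^ 12 := by
  have hn0 : (0 : ℝ) < n := by exact_mod_cast hn
  obtain ⟨f, hf⟩ : ∃ f : ℕ → ℝ, f = fun a : ℕ => if a = 0 then 0 else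
    Real.exp (-(14 * ((a : ℝ) * Real.log (Real.exp 1 * n / (a : ℝ))))) := ⟨_, rfl⟩
  have e1 : ∑ S ∈ (Finset.univ : Finset (Fin n)).powerset.filter Finset.Nonempty,
      Real.exp (-(14 * (S.card * Real.log (Real.exp 1 * n / S.card)))) =
      ∑ S ∈ (Finset.univ : Finset (Fin n)).powerset, f S.card := by
    rw [Finset.sum_filter]
    refine Finset.sum_congr rfl fun S _ => ?_
    rw [hf]
    by_cases hS : S.Nonempty
    · rw [if_pos hS]; dsimp only; rw [if_neg hS.card_pos.ne']
    · rw [if_neg hS, Finset.not_nonempty_iff_eq_empty.1 hS]; simp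
  rw [e1, Finset.sum_powerset_apply_card]
  simp only [Finset.card_univ, Fintype.card_fin]
  rw [Finset.sum_range_succ']
  have h0 : n.choose 0 • f 0 = 0 := by simp [hf]
  rw [h0, add_zero]
  calc ∑ a ∈ Finset.range n, n.choose (a + 1) • f (a + 1)
      ≤ ∑ a ∈ Finset.range n, ((n : ℝ)⁻¹) ^ 13 := by
        refine Finset.sum_le_sum fun a ha => ?_
        have ha' : a + 1 ≤ n := Finset.mem_range.1 ha
        have hfa : f (a + 1) = Real.exp (-(14 * (((a + 1 : ℕ) : ℝ) *
            Real.log (Real.exp 1 * n / ((a + 1 : ℕ) : ℝ))))) := by rw [hf]; simp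
        rw [nsmul_eq_mul, hfa]
        have hc := choose_le_exp (by omega : 1 ≤ a + 1) ha'
        have hl := log_le_card_mul_log (by omega : 1 ≤ a + 1) ha'
        set H := ((a + 1 : ℕ) : ℝ) * Real.log (Real.exp 1 * n / ((a + 1 : ℕ) : ℝ))
        calc (n.choose (a + 1) : ℝ) * Real.exp (-(14 * H)) ≤ Real.exp H * Real.exp (-(14 * H)) := by
              gcongr
          _ = Real.exp (-(13 * H)) := by rw [← Real.exp_add]; ring_nf
          _ ≤ Real.exp (-(13 * Real.log n)) := Real.exp_le_exp.2 (by linarith)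
          _ = ((n : ℝ)⁻¹) ^ 13 := by
              rw [← Real.exp_log (inv_pos.2 hn0), ← Real.exp_nat_mul, Real.log_inv]
              norm_num
    _ = ((n : ℝ)⁻¹) ^ 12 := by
        rw [Finset.sum_const, Finset.card_range, nsmul_eq_mul, pow_succ _ 12]
        field_simp

/-! ### Spectral norm of the noise -/

section Spectral

variable {Ω : Type*} [MeasurableSpace Ω] {μ : Measure Ω} [IsProbabilityMeasure μ]
  {n k d : ℕ} {p q : ℝ} {Φ : Fin n → Fin k} {W : Edge n d → Ω → ℝ}

theorem exp_neg_mul_log {n : ℕ} (hn : 0 < n) (r : ℕ) :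
    Real.exp (-(r * Real.log n)) = ((n : ℝ)⁻¹) ^ r := by
  have hn0 : (0 : ℝ) < n := by exact_mod_cast hn
  rw [← Real.exp_log (inv_pos.2 hn0), ← Real.exp_nat_mul, Real.log_inv]
  ring_nf

/-- At threshold `eL/n` the variance part of the Bernstein exponent is at most `n` and the deviation
part at least `60n/e ≥ 20n`. So each pair fails with probability at most `e^(-19n)`, which beats the
at most `25^n ≤ e^(4n)` pairs. -/
theorem IsWHSBM.measure_light_le (h : IsWHSBM μ p q Φ W) (hqp : q ≤ p) (hd : 2 ≤ d) (hn : 0 < n)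
    {L : ℝ} (hL : 1 ≤ L) (hL2 : L ^ 2 = n * (((n - 2).choose (d - 2) : ℝ) * p))
    {F : Finset (Fin n → ℝ)} (hF : F.card ≤ 5 ^ n) (hF1 : ∀ x ∈ F, ∑ i, x i ^ 2 ≤ 1) :
    μ.real (⋃ z ∈ F ×ˢ F, {ω | 60 * (d : ℝ) ^ 2 * L ≤
      ∑ i, ∑ j, lightPart (Real.exp 1 * L / n) z.1 z.2 i j *
        similarityMatrix (fun e => W e ω - ∫ ω', W e ω' ∂μ) i j}) ≤ ((n : ℝ)⁻¹) ^ 11 := by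
  have hn0 : (0 : ℝ) < n := by exact_mod_cast hn
  have hL0 : 0 < L := by linarith
  have hd1 : (1 : ℝ) ≤ d := by exact_mod_cast (by omega : 1 ≤ d)
  have he2 : 2.7 ≤ Real.exp 1 := by linarith [Real.exp_one_gt_d9]
  have he3 : Real.exp 1 ≤ 3 := by linarith [Real.exp_one_lt_d9]
  have hτ : 0 < Real.exp 1 * L / n := by positivity
  have hone : ∀ z ∈ F ×ˢ F, μ.real {ω | 60 * (d : ℝ) ^ 2 * L ≤
      ∑ i, ∑ j, lightPart (Real.exp 1 * L / n) z.1 z.2 i j *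
        similarityMatrix (fun e => W e ω - ∫ ω', W e ω' ∂μ) i j} ≤ Real.exp (-(19 * n)) := by
    intro z hz
    obtain ⟨hz1, hz2⟩ := Finset.mem_product.1 hz
    refine (h.measure_deviation_ge_le hqp hd hτ (abs_lightPart_le hτ.le z.1 z.2)
      (sum_lightPart_sq_le _ (hF1 _ hz1) (hF1 _ hz2)) _).trans (Real.exp_le_exp.2 ?_)
    have hm : ((n - 2).choose (d - 2) : ℝ) * p = L ^ 2 / n := by rw [hL2]; field_simp
    rw [hm]
    have e1 : L ^ 2 / n * 1 / ((d : ℝ) ^ 2 * (Real.exp 1 * L / n) ^ 2) =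
        n / ((d : ℝ) ^ 2 * Real.exp 1 ^ 2) := by field_simp
    have e2 : 60 * (d : ℝ) ^ 2 * L / ((d : ℝ) ^ 2 * (Real.exp 1 * L / n)) =
        60 * n / Real.exp 1 := by field_simp
    rw [e1, e2]
    have e3 : n / ((d : ℝ) ^ 2 * Real.exp 1 ^ 2) ≤ n := by
      refine div_le_self hn0.le (one_le_mul_of_one_le_of_one_le (one_le_pow₀ hd1) (one_le_pow₀ ?_))
      linarith
    have e4 : 20 * n ≤ 60 * n / Real.exp 1 := by
      rw [le_div_iff₀ (by positivity)]
      nlinarith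
    linarith
  refine (measureReal_biUnion_finset_le _ _).trans ((Finset.sum_le_sum hone).trans ?_)
  rw [Finset.sum_const, nsmul_eq_mul, Finset.card_product]
  have h25 : ((F.card * F.card : ℕ) : ℝ) ≤ Real.exp (4 * n) := by
    calc ((F.card * F.card : ℕ) : ℝ) ≤ ((5 ^ n * 5 ^ n : ℕ) : ℝ) := by
          exact_mod_cast Nat.mul_le_mul hF hF
      _ = (25 : ℝ) ^ n := by push_cast; rw [← mul_pow]; norm_num
      _ ≤ (Real.exp 4) ^ n := by
          refine pow_le_pow_left₀ (by norm_num) ?_ n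
          have : Real.exp 4 = Real.exp 1 ^ 4 := by rw [← Real.exp_nat_mul]; norm_num
          rw [this]
          calc (25 : ℝ) ≤ 2.7 ^ 4 := by norm_num
            _ ≤ _ := pow_le_pow_left₀ (by norm_num) he2 4
      _ = Real.exp (4 * n) := by rw [← Real.exp_nat_mul, mul_comm]
  calc _ ≤ Real.exp (4 * n) * Real.exp (-(19 * n)) := by gcongr
    _ = Real.exp (-(15 * n)) := by rw [← Real.exp_add]; ring_nf
    _ ≤ Real.exp (-((11 : ℕ) * Real.log n)) := by
        refine Real.exp_le_exp.2 ?_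
        have := Real.log_le_sub_one_of_pos hn0
        push_cast; linarith
    _ = _ := exp_neg_mul_log hn 11

/-- A row is a rectangle with one node on one side; with `θ = 1` the exponent is `(e - 16)L² ≤ -12
log n`. The assumption `log n ≤ L²` is what makes every degree bounded without trimming. -/
theorem IsWHSBM.measure_degree_le (h : IsWHSBM μ p q Φ W) (hqp : q ≤ p) (hd : 2 ≤ d) (hn : 2 ≤ n)
    {L : ℝ} (hL2 : L ^ 2 = n * (((n - 2).choose (d - 2) : ℝ) * p)) (hlog : Real.log n ≤ L ^ 2) :
    μ.real (⋃ i ∈ (Finset.univ : Finset (Fin n)), {ω | 16 * (d : ℝ) ^ 2 * L ^ 2 ≤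
      ∑ j, similarityMatrix (fun e => W e ω) i j}) ≤ ((n : ℝ)⁻¹) ^ 11 := by
  have hn0 : (0 : ℝ) < n := by exact_mod_cast (by omega : 0 < n)
  have hone : ∀ i ∈ (Finset.univ : Finset (Fin n)), μ.real {ω | 16 * (d : ℝ) ^ 2 * L ^ 2 ≤
      ∑ j, similarityMatrix (fun e => W e ω) i j} ≤ ((n : ℝ)⁻¹) ^ 12 := by
    intro i _
    have key := h.measure_rect_ge_le hqp hd {i} Finset.univ zero_le_one (16 * L ^ 2)
    simp only [Finset.sum_singleton, one_mul, Finset.card_singleton, Finset.card_univ,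
      Fintype.card_fin, Nat.cast_one, mul_one] at key
    have e : 16 * (d : ℝ) ^ 2 * L ^ 2 = (d : ℝ) ^ 2 * (16 * L ^ 2) := by ring
    rw [e]
    refine key.trans ?_
    rw [← exp_neg_mul_log (by omega) 12]
    refine Real.exp_le_exp.2 ?_
    have e2 : ((n - 2).choose (d - 2) : ℝ) * p * n = L ^ 2 := by rw [hL2]; ring
    rw [e2]
    push_cast
    nlinarith [Real.exp_one_lt_d9, sq_nonneg L]
  refine (measureReal_biUnion_finset_le _ _).trans ((Finset.sum_le_sum hone).trans ?_)
  rw [Finset.sum_const, nsmul_eq_mul, Finset.card_univ, Fintype.card_fin, pow_succ _ 11]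
  field_simp
  rfl

/-- The factor 16 lets the deviation absorb the exponential moment and leave 14 copies of the
entropy of each set. Summing over both sets and the `3n` values of `θ` gives `3n · n⁻²⁴`. -/
theorem IsWHSBM.measure_discrepancy_le (h : IsWHSBM μ p q Φ W) (hqp : q ≤ p) (hd : 2 ≤ d)
    (hn : 2 ≤ n) {L : ℝ} (hL2 : L ^ 2 = n * (((n - 2).choose (d - 2) : ℝ) * p)) :
    μ.real (⋃ z ∈ ((Finset.univ : Finset (Fin n)).powerset.filter Finset.Nonempty ×ˢ
        (Finset.univ : Finset (Fin n)).powerset.filter Finset.Nonempty) ×ˢ Finset.Icc 1 (3 * n),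
      {ω | 16 * (d : ℝ) ^ 2 * (L ^ 2 / n * z.1.1.card * z.1.2.card * Real.exp z.2 +
        z.1.1.card * Real.log (Real.exp 1 * n / z.1.1.card) +
        z.1.2.card * Real.log (Real.exp 1 * n / z.1.2.card)) ≤
      z.2 * ∑ i ∈ z.1.1, ∑ j ∈ z.1.2, similarityMatrix (fun e => W e ω) i j}) ≤
      ((n : ℝ)⁻¹) ^ 11 := by
  have hn0 : (0 : ℝ) < n := by exact_mod_cast (by omega : 0 < n)
  have hn2 : (2 : ℝ) ≤ n := by exact_mod_cast hn
  obtain ⟨H, hH⟩ : ∃ H : Finset (Fin n) → ℝ, H = fun S =>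
    S.card * Real.log (Real.exp 1 * n / S.card) := ⟨_, rfl⟩
  have hm : ((n - 2).choose (d - 2) : ℝ) * p = L ^ 2 / n := by rw [hL2]; field_simp
  have hH0 : ∀ S : Finset (Fin n), S.Nonempty → 0 ≤ H S := by
    intro S hS
    have hc : S.card ≤ n := by simpa using S.card_le_univ
    rw [hH]
    exact (Real.log_nonneg (by linarith)).trans (log_le_card_mul_log hS.card_pos hc)
  refine (measureReal_biUnion_finset_le _ _).trans
    ((Finset.sum_le_sum (g := fun z => Real.exp (-(14 * H z.1.1)) * Real.exp (-(14 * H z.1.2)))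
      ?_).trans ?_)
  · rintro ⟨⟨S, T⟩, θ⟩ hz
    simp only [Finset.mem_product, Finset.mem_filter, Finset.mem_Icc] at hz
    have hS := hH0 S hz.1.1.2
    have hT := hH0 T hz.1.2.2
    have key := h.measure_rect_ge_le hqp hd S T (Nat.cast_nonneg θ)
      (16 * (L ^ 2 / n * S.card * T.card * Real.exp θ + H S + H T))
    have e : ∀ r : ℝ, 16 * (d : ℝ) ^ 2 * r = (d : ℝ) ^ 2 * (16 * r) := fun r => by ring
    dsimp only
    rw [hH] at key ⊢
    rw [e]
    refine key.trans ?_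
    rw [← Real.exp_add, hm]
    refine Real.exp_le_exp.2 ?_
    have hpos : 0 ≤ L ^ 2 / n * S.card * T.card * Real.exp θ :=
      mul_nonneg (mul_nonneg (mul_nonneg (div_nonneg (sq_nonneg L) hn0.le) (Nat.cast_nonneg _))
        (Nat.cast_nonneg _)) (Real.exp_pos _).le
    rw [hH] at hS hT
    dsimp only at hS hT ⊢
    linarith
  · rw [Finset.sum_product, Finset.sum_comm]
    simp only [Finset.sum_product, ← Finset.mul_sum, ← Finset.sum_mul]
    rw [Finset.sum_const, nsmul_eq_mul, Nat.card_Icc]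
    have hs := sum_exp_neg_card_mul_log_le (n := n) (by omega)
    have hs' : ∑ S ∈ (Finset.univ : Finset (Fin n)).powerset.filter Finset.Nonempty,
        Real.exp (-(14 * H S)) ≤ ((n : ℝ)⁻¹) ^ 12 := by rw [hH]; exact hs
    have h0 : 0 ≤ ∑ S ∈ (Finset.univ : Finset (Fin n)).powerset.filter Finset.Nonempty,
        Real.exp (-(14 * H S)) := Finset.sum_nonneg fun S _ => (Real.exp_pos _).le
    set E := ∑ S ∈ (Finset.univ : Finset (Fin n)).powerset.filter Finset.Nonempty,
        Real.exp (-(14 * H S))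
    calc E * (((3 * n + 1 - 1 : ℕ) : ℝ) * E) = ((3 * n + 1 - 1 : ℕ) : ℝ) * (E * E) := by ring
      _ ≤ ((3 * n + 1 - 1 : ℕ) : ℝ) * (((n : ℝ)⁻¹) ^ 12 * ((n : ℝ)⁻¹) ^ 12) :=
          mul_le_mul_of_nonneg_left (mul_le_mul hs' hs' h0 (by positivity)) (Nat.cast_nonneg _)
      _ = 3 * ((n : ℝ)⁻¹) ^ 12 * ((n : ℝ)⁻¹) ^ 11 := by
          rw [Nat.add_sub_cancel]; push_cast; field_simp
      _ ≤ 1 * ((n : ℝ)⁻¹) ^ 11 := by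
          refine mul_le_mul_of_nonneg_right ?_ (by positivity)
          calc 3 * ((n : ℝ)⁻¹) ^ 12 ≤ 3 * (2⁻¹ : ℝ) ^ 12 := by gcongr
            _ ≤ 1 := by norm_num
      _ = _ := one_mul _

/-- Spectral concentration of the similarity matrix, without logarithmic loss. -/
theorem IsWHSBM.measure_not_quadratic_le (h : IsWHSBM μ p q Φ W) (hqp : q ≤ p) (hd : 2 ≤ d)
    (hn : 2 ≤ n) {L : ℝ} (hL : 1 ≤ L) (hL2 : L ^ 2 = n * (((n - 2).choose (d - 2) : ℝ) * p))
    (hlog : Real.log n ≤ L ^ 2) :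
    μ.real {ω | ¬ ∀ x : Fin n → ℝ, ∑ i, ∑ j, x i * x j *
      similarityMatrix (fun e => W e ω - ∫ ω', W e ω' ∂μ) i j ≤
        20000 * (d : ℝ) ^ 2 * L * ∑ i, x i ^ 2} ≤ 3 * ((n : ℝ)⁻¹) ^ 11 := by
  obtain ⟨F, hFc, hF1, hFn⟩ := exists_finset_norming n
  have hB1 := h.measure_light_le hqp hd (by omega) hL hL2 hFc hF1
  have hB2 := h.measure_degree_le hqp hd hn hL2 hlog
  have hB3 := h.measure_discrepancy_le hqp hd hn hL2
  have hB0 : μ.real {ω | ¬ ∀ e, W e ω ∈ Set.Icc (0 : ℝ) 1} = 0 := by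
    rw [measureReal_def, ae_iff.1 (ae_all_iff.2 h.weight_mem), ENNReal.toReal_zero]
  set B1 := ⋃ z ∈ F ×ˢ F, {ω | 60 * (d : ℝ) ^ 2 * L ≤
      ∑ i, ∑ j, lightPart (Real.exp 1 * L / n) z.1 z.2 i j *
        similarityMatrix (fun e => W e ω - ∫ ω', W e ω' ∂μ) i j} with hB1d
  set B2 := ⋃ i ∈ (Finset.univ : Finset (Fin n)), {ω | 16 * (d : ℝ) ^ 2 * L ^ 2 ≤
      ∑ j, similarityMatrix (fun e => W e ω) i j} with hB2d
  set B3 := ⋃ z ∈ ((Finset.univ : Finset (Fin n)).powerset.filter Finset.Nonempty ×ˢ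
        (Finset.univ : Finset (Fin n)).powerset.filter Finset.Nonempty) ×ˢ Finset.Icc 1 (3 * n),
      {ω | 16 * (d : ℝ) ^ 2 * (L ^ 2 / n * z.1.1.card * z.1.2.card * Real.exp z.2 +
        z.1.1.card * Real.log (Real.exp 1 * n / z.1.1.card) +
        z.1.2.card * Real.log (Real.exp 1 * n / z.1.2.card)) ≤
      z.2 * ∑ i ∈ z.1.1, ∑ j ∈ z.1.2, similarityMatrix (fun e => W e ω) i j} with hB3d
  have hsub : {ω | ¬ ∀ x : Fin n → ℝ, ∑ i, ∑ j, x i * x j *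
      similarityMatrix (fun e => W e ω - ∫ ω', W e ω' ∂μ) i j ≤
        20000 * (d : ℝ) ^ 2 * L * ∑ i, x i ^ 2} ⊆
      ({ω | ¬ ∀ e, W e ω ∈ Set.Icc (0 : ℝ) 1} ∪ B1) ∪ (B2 ∪ B3) := by
    intro ω hω
    by_contra hcon
    apply hω
    simp only [Set.mem_union, not_or] at hcon
    obtain ⟨⟨hc0, hc1⟩, hc2, hc3⟩ := hcon
    have hw : ∀ e, W e ω ∈ Set.Icc (0 : ℝ) 1 := not_not.1 hc0
    have hd1 : (1 : ℝ) ≤ (d : ℝ) ^ 2 := one_le_pow₀ (by exact_mod_cast (by omega : 1 ≤ d))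
    intro x
    -- With `K = 60d²` and `κ = 16d²` the bilinear bound is at most `4861 d² L`; passing to
    -- quadratic forms costs a factor 4, and `4 · 4861 ≤ 20000`.
    refine (quadratic_le_of_norming hFn (B := (60 * (d : ℝ) ^ 2 + 1 + 300 * (16 * (d : ℝ) ^ 2)) * L)
      (fun x hx y hy => ?_) x).trans ?_
    · refine bilinear_le_of_light (by omega) hd h.p_mem.1 (fun e => (hw e).1) h.integral_nonneg
        (h.integral_le hqp) hL hL2 (by positivity) (fun i => ?_) (fun S T hS hT θ h1 h2 => ?_)
        (hF1 x hx) (hF1 y hy) ?_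
      · by_contra hlt
        exact hc2 (Set.mem_biUnion (Finset.mem_univ i) (not_le.1 hlt).le)
      · by_contra hlt
        refine hc3 (Set.mem_biUnion (x := ((S, T), θ)) ?_ (not_le.1 hlt).le)
        simp [hS, hT, h1, h2]
      · by_contra hlt
        exact hc1 (Set.mem_biUnion (x := (x, y)) (Finset.mem_product.2 ⟨hx, hy⟩) (not_le.1 hlt).le)
    · have hs : 0 ≤ ∑ i, x i ^ 2 := Finset.sum_nonneg fun i _ => sq_nonneg _
      refine mul_le_mul_of_nonneg_right ?_ hs
      nlinarith
  calc _ ≤ μ.real (({ω | ¬ ∀ e, W e ω ∈ Set.Icc (0 : ℝ) 1} ∪ B1) ∪ (B2 ∪ B3)) :=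
        measureReal_mono hsub
    _ ≤ (μ.real {ω | ¬ ∀ e, W e ω ∈ Set.Icc (0 : ℝ) 1} + μ.real B1) + (μ.real B2 + μ.real B3) :=
        (measureReal_union_le _ _).trans
          (add_le_add (measureReal_union_le _ _) (measureReal_union_le _ _))
    _ ≤ _ := by rw [hB0]; linarith

end Spectral

/-! ### Deterministic analysis of the semidefinite program -/

section SDP

open Matrix

theorem clusterMatrix_apply {n k : ℕ} (Φ : Fin n → Fin k) (i j : Fin n) :
    clusterMatrix Φ i j = if Φ i = Φ j then 1 else 0 := by
  simp [clusterMatrix, membershipMatrix, Matrix.mul_apply, eq_comm]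

theorem clusterMatrix_mem_sdpFeasible {n k : ℕ} (Φ : Fin n → Fin k) :
    clusterMatrix Φ ∈ sdpFeasible n := by
  refine ⟨?_, ?_, fun i j => ?_⟩
  · have := posSemidef_self_mul_conjTranspose (membershipMatrix Φ)
    rwa [conjTranspose_eq_transpose_of_trivial] at this
  · simp only [matInner, clusterMatrix_apply, Matrix.one_apply, ite_mul, one_mul, zero_mul,
      Finset.sum_ite_eq, Finset.mem_univ, if_true]
    simp
  · rw [clusterMatrix_apply]
    split_ifs <;> norm_num

/-- The orthogonal projection onto the span of the community indicators. -/
noncomputable def clusterProj {n k : ℕ} (Φ : Fin n → Fin k) : Matrix (Fin n) (Fin n) ℝ :=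
  Matrix.of fun i j => if Φ i = Φ j then ((communitySize Φ (Φ i) : ℝ))⁻¹ else 0

theorem communitySize_apply_pos {n k : ℕ} (Φ : Fin n → Fin k) (i : Fin n) :
    0 < communitySize Φ (Φ i) :=
  Finset.card_pos.2 ⟨i, by simp⟩

theorem clusterProj_mul_apply {n k : ℕ} (Φ : Fin n → Fin k) (M : Matrix (Fin n) (Fin n) ℝ)
    (i j : Fin n) : (clusterProj Φ * M) i j =
      ((communitySize Φ (Φ i) : ℝ))⁻¹ * ∑ l with Φ l = Φ i, M l j := by
  simp only [Matrix.mul_apply, clusterProj, Matrix.of_apply, ite_mul, zero_mul, Finset.mul_sum,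
    Finset.sum_filter, mul_ite, mul_zero, eq_comm (a := Φ i)]

theorem clusterProj_transpose {n k : ℕ} (Φ : Fin n → Fin k) :
    (clusterProj Φ)ᵀ = clusterProj Φ := by
  ext i j
  simp only [Matrix.transpose_apply, clusterProj, Matrix.of_apply]
  by_cases h : Φ i = Φ j
  · rw [if_pos h, if_pos h.symm, h]
  · rw [if_neg h, if_neg (Ne.symm h)]

theorem clusterProj_mul_of_const {n k : ℕ} (Φ : Fin n → Fin k) {M : Matrix (Fin n) (Fin n) ℝ}
    (hM : ∀ i l j, Φ i = Φ l → M i j = M l j) : clusterProj Φ * M = M := by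
  ext i j
  rw [clusterProj_mul_apply]
  have h1 : ∑ l with Φ l = Φ i, M l j = communitySize Φ (Φ i) * M i j := by
    rw [Finset.sum_congr rfl (g := fun _ => M i j), Finset.sum_const, nsmul_eq_mul, communitySize]
    intro l hl
    exact hM l i j (by simpa using hl)
  have h2 : (communitySize Φ (Φ i) : ℝ) ≠ 0 := by
    exact_mod_cast (communitySize_apply_pos Φ i).ne'
  rw [h1, inv_mul_cancel_left₀ h2]

theorem clusterProj_mul_self {n k : ℕ} (Φ : Fin n → Fin k) :
    clusterProj Φ * clusterProj Φ = clusterProj Φ := by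
  refine clusterProj_mul_of_const Φ fun i l j h => ?_
  simp only [clusterProj, Matrix.of_apply, h]

theorem clusterProj_mul_clusterMatrix {n k : ℕ} (Φ : Fin n → Fin k) :
    clusterProj Φ * clusterMatrix Φ = clusterMatrix Φ := by
  refine clusterProj_mul_of_const Φ fun i l j h => ?_
  simp only [clusterMatrix_apply, h]

theorem clusterMatrix_transpose {n k : ℕ} (Φ : Fin n → Fin k) :
    (clusterMatrix Φ)ᵀ = clusterMatrix Φ := by
  ext i j
  simp only [Matrix.transpose_apply, clusterMatrix_apply, eq_comm]

theorem clusterMatrix_mul_clusterProj {n k : ℕ} (Φ : Fin n → Fin k) :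
    clusterMatrix Φ * clusterProj Φ = clusterMatrix Φ := by
  rw [← clusterMatrix_transpose, ← clusterProj_transpose, ← Matrix.transpose_mul,
    clusterProj_mul_clusterMatrix]

/-- Averaging over communities does not increase the largest entry. -/
theorem abs_clusterProj_mul_le {n k : ℕ} (Φ : Fin n → Fin k) {M : Matrix (Fin n) (Fin n) ℝ}
    {c : ℝ} (hM : ∀ i j, |M i j| ≤ c) (i j : Fin n) : |(clusterProj Φ * M) i j| ≤ c := by
  have h2 : (0 : ℝ) < communitySize Φ (Φ i) := by exact_mod_cast communitySize_apply_pos Φ i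
  rw [clusterProj_mul_apply, abs_mul, abs_of_pos (inv_pos.2 h2), inv_mul_le_iff₀ h2]
  refine (Finset.abs_sum_le_sum_abs _ _).trans ((Finset.sum_le_sum fun l _ => hM l j).trans ?_)
  rw [Finset.sum_const, nsmul_eq_mul, communitySize]

theorem abs_trace_mul_le {n : ℕ} {M D : Matrix (Fin n) (Fin n) ℝ} {c : ℝ}
    (hM : ∀ i j, |M i j| ≤ c) : |(M * D).trace| ≤ c * ∑ i, ∑ j, |D i j| := by
  simp only [Matrix.trace, Matrix.diag, Matrix.mul_apply]
  rw [Finset.sum_comm, Finset.mul_sum]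
  refine (Finset.abs_sum_le_sum_abs _ _).trans (Finset.sum_le_sum fun i _ => ?_)
  rw [Finset.mul_sum]
  refine (Finset.abs_sum_le_sum_abs _ _).trans (Finset.sum_le_sum fun j _ => ?_)
  rw [abs_mul]
  exact mul_le_mul_of_nonneg_right (hM _ _) (abs_nonneg _)

-- Writing `Z = CᵀC`, the trace is the sum of the quadratic form of `N` over the rows of `C`; a
-- one-sided bound on the form is enough.
open scoped MatrixOrder in
theorem trace_mul_posSemidef_le {n : ℕ} {N Z : Matrix (Fin n) (Fin n) ℝ} {B : ℝ}
    (hN : ∀ x : Fin n → ℝ, ∑ i, ∑ j, x i * x j * N i j ≤ B * ∑ i, x i ^ 2) (hZ : Z.PosSemidef) :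
    (N * Z).trace ≤ B * Z.trace := by
  obtain ⟨C, rfl⟩ : ∃ C : Matrix (Fin n) (Fin n) ℝ, Z = Cᵀ * C := by
    obtain ⟨C, hC⟩ := CStarAlgebra.nonneg_iff_eq_star_mul_self.mp hZ.nonneg
    exact ⟨C, by rwa [Matrix.star_eq_conjTranspose, conjTranspose_eq_transpose_of_trivial] at hC⟩
  rw [← Matrix.mul_assoc, Matrix.trace_mul_comm (N * Cᵀ), Matrix.trace_mul_comm Cᵀ]
  simp only [Matrix.trace, Matrix.diag, Finset.mul_sum]
  refine Finset.sum_le_sum fun r _ => ?_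
  have h := hN (C r)
  calc (C * (N * Cᵀ)) r r = ∑ i, ∑ j, C r i * C r j * N i j := by
        simp only [Matrix.mul_apply, Matrix.transpose_apply, Finset.mul_sum]
        exact Finset.sum_congr rfl fun i _ => Finset.sum_congr rfl fun j _ => by ring
    _ ≤ B * ∑ i, C r i ^ 2 := h
    _ = B * (C * Cᵀ) r r := by
        simp only [Matrix.mul_apply, Matrix.transpose_apply, pow_two]

/-- Control of the noise term of the objective on feasible directions. -/
theorem abs_trace_noise_le {n k : ℕ} (Φ : Fin n → Fin k) {N Y : Matrix (Fin n) (Fin n) ℝ}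
    (hN : Nᵀ = N) {δ s : ℝ} (hδ : 0 ≤ δ) (hs : 0 < s) (hsize : ∀ i, s ≤ communitySize Φ (Φ i))
    (hrow : ∀ i j, |∑ l with Φ l = Φ i, N l j| ≤ communitySize Φ (Φ i) * δ)
    (hspec : ∀ x : Fin n → ℝ, ∑ i, ∑ j, x i * x j * N i j ≤ s * δ * ∑ i, x i ^ 2)
    (hY : Y.PosSemidef) (htr : Y.trace = (clusterMatrix Φ).trace) :
    -(4 * δ * ∑ i, ∑ j, |(clusterMatrix Φ - Y) i j|) ≤ (N * (clusterMatrix Φ - Y)).trace := by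
  set X := clusterMatrix Φ with hX
  set P := clusterProj Φ with hP
  obtain ⟨D, hD⟩ : ∃ D, D = X - Y := ⟨_, rfl⟩
  rw [← hD]
  have hPX : P * X = X := clusterProj_mul_clusterMatrix Φ
  have hXP : X * P = X := clusterMatrix_mul_clusterProj Φ
  have hPP : P * P = P := clusterProj_mul_self Φ
  have hPt : Pᵀ = P := clusterProj_transpose Φ
  have hPN : ∀ i j, |(P * N) i j| ≤ δ := by
    intro i j
    have h2 : (0 : ℝ) < communitySize Φ (Φ i) := by exact_mod_cast communitySize_apply_pos Φ i
    rw [hP, clusterProj_mul_apply, abs_mul, abs_of_pos (inv_pos.2 h2), inv_mul_le_iff₀ h2]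
    exact hrow i j
  have hNP : ∀ i j, |(N * P) i j| ≤ δ := by
    intro i j
    have : N * P = (P * N)ᵀ := by rw [Matrix.transpose_mul, hN, hPt]
    rw [this, Matrix.transpose_apply]
    exact hPN j i
  have hPNP : ∀ i j, |(P * (N * P)) i j| ≤ δ := abs_clusterProj_mul_le Φ hNP
  obtain ⟨Z, hZ⟩ : ∃ Z, Z = (1 - P) * Y * (1 - P) := ⟨_, rfl⟩
  have hZpsd : Z.PosSemidef := by
    have h1 := hY.conjTranspose_mul_mul_same (1 - P)
    have h2 : (1 - P)ᴴ = 1 - P := by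
      rw [conjTranspose_eq_transpose_of_trivial, Matrix.transpose_sub, Matrix.transpose_one, hPt]
    rwa [h2, ← hZ] at h1
  -- Since `PX = XP = X`, compressing `D` by `1 - P` kills `X` and leaves `-Z`.
  have hdec : D = P * D + D * P - P * D * P - Z := by
    rw [hD, hZ]
    simp only [Matrix.mul_sub, Matrix.sub_mul, Matrix.one_mul, Matrix.mul_one, hPX, hXP]
    abel
  -- Equal traces of `X` and `Y` enter here: `tr Z = tr Y - tr(PY) = tr X - tr(PY) = tr(PD)`.
  have hZtr : Z.trace = (P * D).trace := by
    have h1 : Z.trace = (Y * (1 - P)).trace := by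
      rw [hZ, Matrix.trace_mul_comm, ← Matrix.mul_assoc]
      have : (1 - P) * (1 - P) = 1 - P := by
        simp only [Matrix.mul_sub, Matrix.sub_mul, Matrix.one_mul, Matrix.mul_one, hPP]
        abel
      rw [this, Matrix.trace_mul_comm]
    rw [h1, hD, Matrix.mul_sub, Matrix.mul_sub, hPX, Matrix.mul_one, Matrix.trace_sub,
      Matrix.trace_sub, htr, Matrix.trace_mul_comm P]
  have hPent : ∀ i j, |P i j| ≤ s⁻¹ := by
    intro i j
    have h2 : (0 : ℝ) < communitySize Φ (Φ i) := by exact_mod_cast communitySize_apply_pos Φ i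
    simp only [hP, clusterProj, Matrix.of_apply]
    split_ifs
    · rw [abs_of_pos (inv_pos.2 h2)]
      exact inv_anti₀ hs (hsize i)
    · simpa using hs.le
  have t1 := (abs_le.1 (abs_trace_mul_le (D := D) hNP)).1
  have t2 := (abs_le.1 (abs_trace_mul_le (D := D) hPN)).1
  have t3 := (abs_le.1 (abs_trace_mul_le (D := D) hPNP)).2
  have t4 := (abs_le.1 (abs_trace_mul_le (D := D) hPent)).2
  have t5 := trace_mul_posSemidef_le hspec hZpsd
  -- Cyclicity of the trace moves every `P` next to `N`. Each of the four terms then costs at most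
  -- `δ‖D‖₁`, whence the factor 4.
  have e : (N * D).trace = (N * P * D).trace + (P * N * D).trace - (P * (N * P) * D).trace -
      (N * Z).trace := by
    conv_lhs => rw [hdec]
    rw [Matrix.mul_sub, Matrix.mul_sub, Matrix.mul_add, Matrix.trace_sub, Matrix.trace_sub,
      Matrix.trace_add, ← Matrix.mul_assoc, ← Matrix.mul_assoc N D P,
      Matrix.trace_mul_comm (N * D) P, ← Matrix.mul_assoc P N D, ← Matrix.mul_assoc N (P * D) P,
      Matrix.trace_mul_comm (N * (P * D)) P]
    simp only [Matrix.mul_assoc]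
  have t6 : s * δ * Z.trace ≤ δ * ∑ i, ∑ j, |D i j| := by
    rw [hZtr]
    calc s * δ * (P * D).trace ≤ s * δ * (s⁻¹ * ∑ i, ∑ j, |D i j|) :=
          mul_le_mul_of_nonneg_left t4 (by positivity)
      _ = _ := by field_simp
  rw [e]
  linarith

theorem trace_mul_eq_matInner {n : ℕ} {M D : Matrix (Fin n) (Fin n) ℝ} (hM : Mᵀ = M) :
    (M * D).trace = matInner M D := by
  rw [← hM]
  simp only [Matrix.trace, Matrix.diag, Matrix.mul_apply, matInner, Matrix.transpose_apply]
  rw [Finset.sum_comm]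
  exact Finset.sum_congr rfl fun i _ => Finset.sum_congr rfl fun j _ => by
    rw [← Matrix.transpose_apply M, hM]

/-- Deterministic sufficient condition for exact recovery by the semidefinite program. -/
theorem isUniqueSDPOptimum_of_noise_le {n k : ℕ} (Φ : Fin n → Fin k)
    {A E : Matrix (Fin n) (Fin n) ℝ} (hA : Aᵀ = A) (hE : Eᵀ = E) {lam gap s : ℝ}
    (hgap : 0 < gap) (hs : 0 < s) (hsize : ∀ i, s ≤ communitySize Φ (Φ i))
    (hin : ∀ i j, i ≠ j → Φ i = Φ j → gap / 4 ≤ E i j - lam)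
    (hout : ∀ i j, Φ i ≠ Φ j → gap / 4 ≤ lam - E i j)
    (hrow : ∀ i j, |∑ l with Φ l = Φ i, (A - E) l j| ≤ communitySize Φ (Φ i) * (gap / 32))
    (hspec : ∀ x : Fin n → ℝ, ∑ i, ∑ j, x i * x j * (A - E) i j ≤
      s * (gap / 32) * ∑ i, x i ^ 2) :
    IsUniqueSDPOptimum A lam (clusterMatrix Φ) := by
  refine ⟨clusterMatrix_mem_sdpFeasible Φ, fun Y hY hne => ?_⟩
  obtain ⟨hYpsd, hYtr, hY01⟩ := hY
  obtain ⟨-, hXtr, -⟩ := clusterMatrix_mem_sdpFeasible Φ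
  rw [← trace_mul_eq_matInner Matrix.transpose_one, Matrix.one_mul] at hYtr hXtr
  -- The diagonal of `D` vanishes, so the diagonals of `E` and of the penalty play no role in the
  -- signal.
  have hdiag : ∀ i, Y i i = 1 := by
    have hsum : ∑ i, (1 - Y i i) = 0 := by
      rw [Finset.sum_sub_distrib]
      have : ∑ i, Y i i = n := hYtr
      rw [this]; simp
    intro i
    have := (Finset.sum_eq_zero_iff_of_nonneg fun i _ => sub_nonneg.2 (hY01 i i).2).1 hsum i
      (Finset.mem_univ i)
    linarith
  have hN : (A - E)ᵀ = A - E := by rw [Matrix.transpose_sub, hA, hE]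
  have hnoise := abs_trace_noise_le Φ hN (by positivity) hs hsize hrow hspec hYpsd
    (hYtr.trans hXtr.symm)
  rw [trace_mul_eq_matInner hN] at hnoise
  obtain ⟨D, hD⟩ : ∃ D, D = clusterMatrix Φ - Y := ⟨_, rfl⟩
  rw [← hD] at hnoise
  have hsignal : gap / 4 * ∑ i, ∑ j, |D i j| ≤ ∑ i, ∑ j, (E i j - lam) * D i j := by
    rw [Finset.mul_sum]
    refine Finset.sum_le_sum fun i _ => ?_
    rw [Finset.mul_sum]
    refine Finset.sum_le_sum fun j _ => ?_
    have hDij : D i j = (if Φ i = Φ j then 1 else 0) - Y i j := by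
      rw [hD, Matrix.sub_apply, clusterMatrix_apply]
    by_cases hij : i = j
    · have h0 : D i j = 0 := by rw [hDij, ← hij, if_pos rfl, hdiag]; ring
      rw [h0]; simp
    · by_cases hΦ : Φ i = Φ j
      · rw [if_pos hΦ] at hDij
        have h0 : 0 ≤ D i j := by rw [hDij]; linarith [(hY01 i j).2]
        rw [abs_of_nonneg h0]
        exact mul_le_mul_of_nonneg_right (hin i j hij hΦ) h0
      · rw [if_neg hΦ] at hDij
        have h0 : D i j ≤ 0 := by rw [hDij]; linarith [(hY01 i j).1]
        rw [abs_of_nonpos h0]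
        nlinarith [mul_le_mul_of_nonneg_right (hout i j hΦ) (neg_nonneg.2 h0)]
  have hpos : 0 < ∑ i, ∑ j, |D i j| := by
    have h0 : ∀ i, 0 ≤ ∑ j, |D i j| := fun i => Finset.sum_nonneg fun j _ => abs_nonneg _
    refine lt_of_le_of_ne (Finset.sum_nonneg fun i _ => h0 i) fun h => hne ?_
    have h1 := (Finset.sum_eq_zero_iff_of_nonneg fun i _ => h0 i).1 h.symm
    ext i j
    have h2 := (Finset.sum_eq_zero_iff_of_nonneg fun j _ => abs_nonneg _).1
      (h1 i (Finset.mem_univ i)) j (Finset.mem_univ j)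
    rw [abs_eq_zero, hD, Matrix.sub_apply] at h2
    linarith
  have hobj : sdpObjective A lam (clusterMatrix Φ) - sdpObjective A lam Y =
      ∑ i, ∑ j, (E i j - lam) * D i j + matInner (A - E) D := by
    simp only [sdpObjective, matInner, ← Finset.sum_sub_distrib, ← Finset.sum_add_distrib]
    refine Finset.sum_congr rfl fun i _ => Finset.sum_congr rfl fun j _ => ?_
    simp only [hD, Matrix.sub_apply, Matrix.smul_apply, Matrix.of_apply, smul_eq_mul]
    ring
  -- The signal exceeds the noise by `(gap/4 - 4 · gap/32)‖D‖₁ = gap/8 · ‖D‖₁ > 0`.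
  nlinarith

end SDP

/-! ### Community averages of the noise and exact recovery -/

section Recovery

variable {Ω : Type*} [MeasurableSpace Ω] {μ : Measure Ω} [IsProbabilityMeasure μ]
  {n k d : ℕ} {p q : ℝ} {Φ : Fin n → Fin k} {W : Edge n d → Ω → ℝ}

theorem IsWHSBM.similarityMatrix_mean (h : IsWHSBM μ p q Φ W) (hd : 2 ≤ d) {i j : Fin n}
    (hij : i ≠ j) : similarityMatrix (fun e => ∫ ω, W e ω ∂μ) i j =
      meanSimilarity d p q Φ (Φ i) (Φ j) := by
  rw [← integral_similarityMatrix hd h hij]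
  have hint : ∀ e, Integrable (W e) μ := fun e =>
    Integrable.of_mem_Icc 0 1 (h.measurable e).aemeasurable (h.weight_mem e)
  simp only [similarityMatrix, Matrix.of_apply, hij, if_false]
  rw [integral_finsetSum _ fun e _ => hint e]

/-- Concentration of the noise summed over one community. -/
theorem IsWHSBM.measure_community_sum_le (h : IsWHSBM μ p q Φ W) (hqp : q ≤ p) (hd : 2 ≤ d)
    {m gap : ℝ} (hm : m = ((n - 2).choose (d - 2) : ℝ) * p) (hgap : 0 < gap) (hgm : gap ≤ m)
    {σ : ℝ} (hσ : |σ| = 1) (i j : Fin n) :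
    μ.real {ω | communitySize Φ (Φ i) * (gap / 32) ≤ σ * ∑ l with Φ l = Φ i,
      similarityMatrix (fun e => W e ω - ∫ ω', W e ω' ∂μ) l j} ≤
      Real.exp (-(communitySize Φ (Φ i) * gap ^ 2 / (4096 * (d : ℝ) ^ 2 * m))) := by
  have hm0 : 0 < m := hgap.trans_le hgm
  have hd0 : (0 : ℝ) < d := by exact_mod_cast (by omega : 0 < d)
  have hσ2 : σ ^ 2 = 1 := by rw [← sq_abs, hσ, one_pow]
  obtain ⟨c, hc⟩ : ∃ c : Fin n → Fin n → ℝ, c = fun a b =>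
    if Φ a = Φ i then (if b = j then σ else 0) else 0 := ⟨_, rfl⟩
  -- `τ = 64m/gap` optimizes the exponent: the variance term is half the deviation term. It is an
  -- admissible bound on the coefficients because `gap ≤ m`.
  have hτ1 : 1 ≤ 64 * m / gap := by rw [le_div_iff₀ hgap]; linarith
  have hc1 : ∀ a b, |c a b| ≤ 64 * m / gap := by
    intro a b
    rw [hc]
    dsimp only
    split_ifs
    · rw [hσ]; exact hτ1
    · rw [abs_zero]; linarith
    · rw [abs_zero]; linarith
  have hV : ∑ a, ∑ b, c a b ^ 2 ≤ communitySize Φ (Φ i) := by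
    have : ∀ a b, c a b ^ 2 = if Φ a = Φ i then (if b = j then 1 else 0) else 0 := by
      intro a b
      rw [hc]
      dsimp only
      split_ifs <;> simp [hσ2]
    simp only [this]
    rw [communitySize, Finset.card_filter]
    push_cast
    refine Finset.sum_le_sum fun a _ => ?_
    split_ifs <;> simp
  have hsum : ∀ M : Matrix (Fin n) (Fin n) ℝ, ∑ a, ∑ b, c a b * M a b =
      σ * ∑ l with Φ l = Φ i, M l j := by
    intro M
    rw [hc, Finset.sum_filter, Finset.mul_sum]
    refine Finset.sum_congr rfl fun a _ => ?_
    by_cases ha : Φ a = Φ i <;> simp [ha]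
  have key := h.measure_deviation_ge_le hqp hd (by linarith : 0 < 64 * m / gap) hc1 hV
    (communitySize Φ (Φ i) * (gap / 32))
  simp only [hsum] at key
  refine key.trans (Real.exp_le_exp.2 (le_of_eq ?_))
  rw [← hm]
  field_simp
  ring

/-- Two signs and `n²` index pairs, each failing with probability at most `n⁻¹⁴`, give `2n⁻¹² ≤
n⁻¹¹`. -/
theorem IsWHSBM.measure_not_row_le (h : IsWHSBM μ p q Φ W) (hqp : q ≤ p) (hd : 2 ≤ d)
    (hn : 2 ≤ n) {m gap : ℝ} (hm : m = ((n - 2).choose (d - 2) : ℝ) * p) (hgap : 0 < gap)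
    (hgm : gap ≤ m)
    (hlog : ∀ i, 14 * Real.log n ≤ communitySize Φ (Φ i) * gap ^ 2 / (4096 * (d : ℝ) ^ 2 * m)) :
    μ.real {ω | ¬ ∀ i j, |∑ l with Φ l = Φ i,
      similarityMatrix (fun e => W e ω - ∫ ω', W e ω' ∂μ) l j| ≤
        communitySize Φ (Φ i) * (gap / 32)} ≤ ((n : ℝ)⁻¹) ^ 11 := by
  have hn2 : (2 : ℝ) ≤ n := by exact_mod_cast hn
  have hn0 : (0 : ℝ) < n := by linarith
  obtain ⟨B, hB⟩ : ∃ B : ℝ → Fin n × Fin n → Set Ω, B = fun σ z =>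
    {ω | communitySize Φ (Φ z.1) * (gap / 32) ≤ σ * ∑ l with Φ l = Φ z.1,
      similarityMatrix (fun e => W e ω - ∫ ω', W e ω' ∂μ) l z.2} := ⟨_, rfl⟩
  have hBle : ∀ σ, |σ| = 1 → ∀ z, μ.real (B σ z) ≤ ((n : ℝ)⁻¹) ^ 14 := by
    intro σ hσ z
    rw [hB, ← exp_neg_mul_log (by omega) 14]
    refine (h.measure_community_sum_le hqp hd hm hgap hgm hσ z.1 z.2).trans
      (Real.exp_le_exp.2 (neg_le_neg ?_))
    simpa using hlog z.1
  have hsub : {ω | ¬ ∀ i j, |∑ l with Φ l = Φ i,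
      similarityMatrix (fun e => W e ω - ∫ ω', W e ω' ∂μ) l j| ≤
        communitySize Φ (Φ i) * (gap / 32)} ⊆ ⋃ z ∈ Finset.univ, (B 1 z ∪ B (-1) z) := by
    intro ω hω
    by_contra hcon
    apply hω
    intro i j
    by_contra hlt
    rw [not_le, lt_abs] at hlt
    refine hcon (Set.mem_biUnion (x := (i, j)) (Finset.mem_univ _) ?_)
    rw [hB]
    rcases hlt with hlt | hlt
    · left
      simpa using hlt.le
    · right
      simpa using hlt.le
  calc _ ≤ μ.real (⋃ z ∈ Finset.univ, (B 1 z ∪ B (-1) z)) :=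
          measureReal_mono hsub (measure_ne_top _ _)
    _ ≤ ∑ z : Fin n × Fin n, μ.real (B 1 z ∪ B (-1) z) := measureReal_biUnion_finset_le _ _
    _ ≤ ∑ _z : Fin n × Fin n, (((n : ℝ)⁻¹) ^ 14 + ((n : ℝ)⁻¹) ^ 14) :=
        Finset.sum_le_sum fun z _ => (measureReal_union_le _ _).trans
          (add_le_add (hBle 1 (by simp) z) (hBle (-1) (by simp) z))
    _ = 2 * (n : ℝ)⁻¹ * ((n : ℝ)⁻¹) ^ 11 := by
        rw [Finset.sum_const, Finset.card_univ, Fintype.card_prod, Fintype.card_fin, nsmul_eq_mul]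
        push_cast
        field_simp
        norm_num
    _ ≤ 1 * ((n : ℝ)⁻¹) ^ 11 := by
        refine mul_le_mul_of_nonneg_right ?_ (by positivity)
        rw [← div_eq_mul_inv, div_le_one hn0]
        exact hn2
    _ = _ := one_mul _

theorem minSize_le (Φ : Fin n → Fin k) (a : Fin k) : minSize Φ ≤ communitySize Φ a :=
  ciInf_le (OrderBot.bddBelow _) a

/-- Binomial coefficients grow with the community size. The result is that `pMinus - qPlus` is at
least the gap computed from the smallest community. -/
theorem le_pMinus [Nonempty (Fin k)] (d : ℕ) (hqp : q ≤ p) (Φ : Fin n → Fin k) :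
    ((minSize Φ - 2).choose (d - 2) : ℝ) * (p - q) + qPlus d n q ≤ pMinus d p q Φ := by
  refine le_ciInf fun a => ?_
  simp only [meanSimilarity, Matrix.of_apply, if_true, qPlus]
  have h1 : (minSize Φ - 2).choose (d - 2) ≤ (communitySize Φ a - 2).choose (d - 2) :=
    Nat.choose_le_choose _ (Nat.sub_le_sub_right (minSize_le Φ a) 2)
  have h2 : ((minSize Φ - 2).choose (d - 2) : ℝ) ≤ (communitySize Φ a - 2).choose (d - 2) := by
    exact_mod_cast h1
  nlinarith [mul_le_mul_of_nonneg_right h2 (sub_nonneg.2 hqp)]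

theorem pMinus_le (d : ℕ) (p q : ℝ) (Φ : Fin n → Fin k) (a : Fin k) :
    pMinus d p q Φ ≤ meanSimilarity d p q Φ a a :=
  ciInf_le (Set.finite_range _).bddBelow a

theorem measure_recovery_gt (h : IsWHSBM μ p q Φ W) (hqp : q < p) (hd : 2 ≤ d) (hdn : d ≤ n)
    {lam : ℝ} (hlow : (1 / 4 : ℝ) * pMinus d p q Φ + (3 / 4 : ℝ) * qPlus d n q ≤ lam)
    (hupp : lam ≤ (3 / 4 : ℝ) * pMinus d p q Φ + (1 / 4 : ℝ) * qPlus d n q)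
    (hparam : (minSize Φ : ℝ) ^ 2 * (((minSize Φ - 2).choose (d - 2) : ℕ) : ℝ) ^ 2 * (p - q) ^ 2 ≥
      (640000 * (d : ℝ) ^ 2) ^ 2 * (((n - 2).choose (d - 2) : ℕ) : ℝ) * p *
        ((minSize Φ : ℝ) * Real.log n + n)) :
    μ.real {ω | IsUniqueSDPOptimum (similarityMatrix fun e => W e ω) lam (clusterMatrix Φ)} >
      1 - 6 * (n : ℝ) ^ (-11 : ℤ) := by
  have hn2 : 2 ≤ n := hd.trans hdn
  have hn2R : (2 : ℝ) ≤ n := by exact_mod_cast hn2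
  have hn0 : (0 : ℝ) < n := by linarith
  have hdR : (1 : ℝ) ≤ (d : ℝ) ^ 2 := one_le_pow₀ (by exact_mod_cast (by omega : 1 ≤ d))
  have hlogn : 0 < Real.log n := Real.log_pos (by linarith)
  have hp0 : 0 < p := h.q_mem.1.trans_lt hqp
  have hq0 := h.q_mem.1
  have i0 : Fin n := ⟨0, by omega⟩
  have : Nonempty (Fin k) := ⟨Φ i0⟩
  -- `640000 = 32 · 20000` is the spectral constant times the 32 of the allowed noise level
  -- `gap/32`; it is squared because the condition is.
  obtain ⟨c₁, hc₁⟩ : ∃ c : ℝ, c = (640000 * (d : ℝ) ^ 2) ^ 2 := ⟨_, rfl⟩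
  obtain ⟨s, hs⟩ : ∃ s : ℝ, s = minSize Φ := ⟨_, rfl⟩
  obtain ⟨m, hm⟩ : ∃ m, m = ((n - 2).choose (d - 2) : ℝ) * p := ⟨_, rfl⟩
  obtain ⟨gap, hgap⟩ : ∃ g, g = ((minSize Φ - 2).choose (d - 2) : ℝ) * (p - q) := ⟨_, rfl⟩
  have hm0 : 0 < m := by
    rw [hm]
    have : 0 < (n - 2).choose (d - 2) := Nat.choose_pos (by omega)
    positivity
  have hc1 : 1 ≤ c₁ := by rw [hc₁]; exact one_le_pow₀ (by linarith)
  have hparam' : c₁ * m * (s * Real.log n + n) ≤ (s * gap) ^ 2 := by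
    rw [← hc₁, ← hs] at hparam
    calc _ = c₁ * (((n - 2).choose (d - 2) : ℕ) : ℝ) * p * (s * Real.log n + n) := by rw [hm]; ring
      _ ≤ _ := hparam
      _ = _ := by rw [hgap]; ring
  have hs0' : 0 ≤ s := by rw [hs]; positivity
  have hgap0' : 0 ≤ gap := by rw [hgap]; exact mul_nonneg (Nat.cast_nonneg _) (by linarith)
  -- The right side of the parameter condition is positive, which rules out empty communities and a
  -- vanishing gap.
  have hsg : 0 < (s * gap) ^ 2 := lt_of_lt_of_le (by positivity) hparam'
  have hs0 : 0 < s := lt_of_le_of_ne hs0' fun h0 => by rw [← h0] at hsg; simp at hsg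
  have hgap0 : 0 < gap := lt_of_le_of_ne hgap0' fun h0 => by rw [← h0] at hsg; simp at hsg
  have hsn : s ≤ n := by
    rw [hs]
    have h1 : communitySize Φ (Φ i0) ≤ n := by
      simpa [communitySize] using Finset.card_le_univ (Finset.univ.filter fun i => Φ i = Φ i0)
    exact_mod_cast (minSize_le Φ (Φ i0)).trans h1
  have hgm : gap ≤ m := by
    rw [hgap, hm]
    have h1 : minSize Φ ≤ n := by rw [hs] at hsn; exact_mod_cast hsn
    have h2 : (minSize Φ - 2).choose (d - 2) ≤ (n - 2).choose (d - 2) :=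
      Nat.choose_le_choose _ (Nat.sub_le_sub_right h1 2)
    exact mul_le_mul (by exact_mod_cast h2) (by linarith) (by linarith) (Nat.cast_nonneg _)
  have hsize : ∀ i, s ≤ communitySize Φ (Φ i) := fun i => by
    rw [hs]; exact_mod_cast minSize_le Φ (Φ i)
  -- The two summands of the parameter condition are used separately: `hA` for the community
  -- averages, `hB` for the spectral bound.
  have hA : c₁ * m * Real.log n ≤ s * gap ^ 2 := by
    refine le_of_mul_le_mul_left ?_ hs0
    have : 0 ≤ c₁ * m * n := by positivity
    nlinarith
  have hB : c₁ * (n * m) ≤ (s * gap) ^ 2 := by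
    have : 0 ≤ c₁ * m * (s * Real.log n) := by positivity
    nlinarith
  have hnm1 : 1 ≤ n * m := by
    have h1 : (s * gap) ^ 2 ≤ (n * m) ^ 2 := by gcongr
    have h2 : 0 < (n : ℝ) * m := by positivity
    have h3 : c₁ * (n * m) ≤ (n * m) * (n * m) := by rw [← pow_two]; exact hB.trans h1
    exact hc1.trans (le_of_mul_le_mul_right h3 h2)
  -- From `hA` with `s ≤ n` and `gap ≤ m`: the parameter condition itself supplies the density
  -- needed for the degree bounds.
  have hnmlog : Real.log n ≤ n * m := by
    have h1 : s * gap ^ 2 ≤ n * m * m := by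
      calc s * gap ^ 2 ≤ n * m ^ 2 := by gcongr
        _ = n * m * m := by ring
    have h2 : Real.log n * m ≤ n * m * m := by
      calc Real.log n * m ≤ c₁ * (Real.log n * m) := le_mul_of_one_le_left (by positivity) hc1
        _ = c₁ * m * Real.log n := by ring
        _ ≤ _ := hA.trans h1
    exact le_of_mul_le_mul_right h2 hm0
  obtain ⟨L, hL⟩ : ∃ L, L = √(n * m) := ⟨_, rfl⟩
  have hL2 : L ^ 2 = n * m := by rw [hL, Real.sq_sqrt (by positivity)]
  have hL1 : 1 ≤ L := by rw [hL]; exact Real.one_le_sqrt.2 hnm1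
  have hLs : 20000 * (d : ℝ) ^ 2 * L ≤ s * (gap / 32) := by
    have h1 : 640000 * (d : ℝ) ^ 2 * L ≤ s * gap := by
      refine le_of_sq_le_sq ?_ (by positivity)
      rw [mul_pow, hL2, ← hc₁]
      exact hB
    linarith
  have hspecP := h.measure_not_quadratic_le hqp.le hd hn2 hL1 (by rw [hL2, hm])
    (by rw [hL2]; exact hnmlog)
  have hrowP := h.measure_not_row_le hqp.le hd hn2 hm hgap0 hgm (fun i => by
    rw [le_div_iff₀ (by positivity)]
    have h1 : s * gap ^ 2 ≤ communitySize Φ (Φ i) * gap ^ 2 :=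
      mul_le_mul_of_nonneg_right (hsize i) (sq_nonneg _)
    refine le_trans ?_ (hA.trans h1)
    have h2 : 14 * 4096 * (d : ℝ) ^ 2 ≤ c₁ := by rw [hc₁]; nlinarith
    calc 14 * Real.log n * (4096 * (d : ℝ) ^ 2 * m) =
          14 * 4096 * (d : ℝ) ^ 2 * (m * Real.log n) := by ring
      _ ≤ c₁ * (m * Real.log n) := by gcongr
      _ = _ := by ring)
  set U := {ω | IsUniqueSDPOptimum (similarityMatrix fun e => W e ω) lam (clusterMatrix Φ)} with hU
  set B1 := {ω | ¬ ∀ x : Fin n → ℝ, ∑ i, ∑ j, x i * x j *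
      similarityMatrix (fun e => W e ω - ∫ ω', W e ω' ∂μ) i j ≤
        20000 * (d : ℝ) ^ 2 * L * ∑ i, x i ^ 2} with hB1
  set B2 := {ω | ¬ ∀ i j, |∑ l with Φ l = Φ i,
      similarityMatrix (fun e => W e ω - ∫ ω', W e ω' ∂μ) l j| ≤
        communitySize Φ (Φ i) * (gap / 32)} with hB2
  have hpq := le_pMinus d hqp.le Φ
  rw [← hgap] at hpq
  -- Covering the whole space and using subadditivity bounds the probability of `U` from below
  -- without its measurability.
  have hcover : (Set.univ : Set Ω) ⊆ U ∪ (B1 ∪ B2) := by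
    intro ω _
    by_contra hcon
    simp only [Set.mem_union, not_or] at hcon
    obtain ⟨hω, hω1, hω2⟩ := hcon
    replace hω1 := not_not.1 hω1
    replace hω2 := not_not.1 hω2
    apply hω
    have hsymm : ∀ w : Edge n d → ℝ, (similarityMatrix w).transpose = similarityMatrix w :=
      fun w => by ext i j; exact similarityMatrix_symm w j i
    refine isUniqueSDPOptimum_of_noise_le Φ (E := similarityMatrix fun e => ∫ ω', W e ω' ∂μ)
      (hsymm _) (hsymm _) hgap0 hs0 hsize ?_ ?_ ?_ ?_
    · intro i j hij hΦ
      rw [h.similarityMatrix_mean hd hij, ← hΦ]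
      have := pMinus_le d p q Φ (Φ i)
      linarith
    · intro i j hΦ
      rw [h.similarityMatrix_mean hd fun hij => hΦ (by rw [hij])]
      have : meanSimilarity d p q Φ (Φ i) (Φ j) = qPlus d n q := by
        simp [meanSimilarity, qPlus, hΦ]
      rw [this]
      linarith
    · rw [similarityMatrix_sub]
      exact hω2
    · rw [similarityMatrix_sub]
      exact fun x => (hω1 x).trans (mul_le_mul_of_nonneg_right hLs
        (Finset.sum_nonneg fun i _ => sq_nonneg _))
  have hone : (1 : ℝ) ≤ μ.real U + (μ.real B1 + μ.real B2) := by
    calc (1 : ℝ) = μ.real Set.univ := by simp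
      _ ≤ μ.real (U ∪ (B1 ∪ B2)) := measureReal_mono hcover
      _ ≤ μ.real U + μ.real (B1 ∪ B2) := measureReal_union_le _ _
      _ ≤ _ := by gcongr; exact measureReal_union_le _ _
  have hz : (n : ℝ) ^ (-11 : ℤ) = ((n : ℝ)⁻¹) ^ 11 := by
    rw [zpow_neg, inv_pow]; norm_cast
  -- The failures add up to at most `3n⁻¹¹ + n⁻¹¹`; positivity makes the comparison with `6n⁻¹¹`
  -- strict.
  have hpos : 0 < ((n : ℝ)⁻¹) ^ 11 := by positivity
  rw [hz]
  linarith

end Recovery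

end HypergraphSBM

theorem theorem4p1 (d : ℕ) (hd : 2 ≤ d) :
    ∃ c₁ : ℝ, 0 < c₁ ∧
      ∀ (n k : ℕ) (_hn : d ≤ n) (p q : ℝ) (_hpq : q < p) (Φ : Fin n → Fin k)
        (Ω : Type*) [MeasurableSpace Ω] (μ : MeasureTheory.Measure Ω)
        [MeasureTheory.IsProbabilityMeasure μ]
        (W : HypergraphSBM.Edge n d → Ω → ℝ) (_hW : HypergraphSBM.IsWHSBM μ p q Φ W)
        (lam : ℝ)
        (_hlam_lower : (1 / 4 : ℝ) * HypergraphSBM.pMinus d p q Φ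
            + (3 / 4 : ℝ) * HypergraphSBM.qPlus d n q ≤ lam)
        (_hlam_upper : lam ≤ (3 / 4 : ℝ) * HypergraphSBM.pMinus d p q Φ
            + (1 / 4 : ℝ) * HypergraphSBM.qPlus d n q)
        (_hparam : (HypergraphSBM.minSize Φ : ℝ) ^ 2
              * (((HypergraphSBM.minSize Φ - 2).choose (d - 2) : ℕ) : ℝ) ^ 2 * (p - q) ^ 2
            ≥ c₁ * (((n - 2).choose (d - 2) : ℕ) : ℝ) * p
              * ((HypergraphSBM.minSize Φ : ℝ) * Real.log (n : ℝ) + (n : ℝ))),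
        μ.real {ω | HypergraphSBM.IsUniqueSDPOptimum
            (HypergraphSBM.similarityMatrix (fun e => W e ω)) lam
            (HypergraphSBM.clusterMatrix Φ)}
          > 1 - 6 * (n : ℝ) ^ (-11 : ℤ) := by
  have hd0 : (0 : ℝ) < d := by exact_mod_cast (by omega : 0 < d)
  refine ⟨(640000 * (d : ℝ) ^ 2) ^ 2, by positivity, ?_⟩
  intro n k hn p q hpq Φ Ω _ μ _ W hW lam hlow hupp hparam
  exact HypergraphSBM.measure_recovery_gt hW hpq hd hn hlow hupp hparam
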